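/- Let $n\ge 2$. For a partition $\lambda\vdash n$ let $d_\lambda$ be the number of standard Young tableaux of shape $\lambda$ (the degree of the irreducible representation of $\mathfrak S_n$ indexed by $\lambda$). For $i\in\lambda$ (that is, $i$ is a part of $\lambda$) let $K_{\lambda,i}\in\mathbb C[\mathfrak S_n]$ be the sum of all permutations of cycle type $\lambda$ in which $n$ lies on a cycle of length $i$; these elements are linearly independent. Let $\mathrm{SYT}_{\lambda,i}$ be the set of standard Young tableaux of shape $\lambda$ in which $n$ stands at the end of a row of length $i$, and let $\Gamma^{\lambda,i}=\sum_{T\in \mathrm{SYT}_{\lambda,i}}e_T$, where $e_T$ is Young's semi-normal unit: $e_T=1$ for the empty tableau and otherwise, if $T$ has $m$ boxes and shape $\rho$, $e_T=\frac{d_\rho}{m!}\,e_{T^*}P_TN_Te_{T^*}$. Here $T^*$ is $T$ with the box of its largest label deleted, $P_T$ is the sum of the permutations preserving the rows of $T$, $N_T$ is the signed sum of the permutations preserving the columns of $T$, and $\mathfrak S_{m-1}\subset\mathfrak S_m$ is the subgroup fixing $m$. The generalized characters are $\gamma^{\mu,j}_{\lambda,i}=\frac{n!}{d_\mu}[K_{\lambda,i}]\Gamma^{\mu,j}$,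 the bracket denoting the coefficient of $K_{\lambda,i}$ in $\Gamma^{\mu,j}$. Let $\mu\vdash n$ and $j\in\mu$. Then $\Gamma^{\mu,j}$ is a linear combination of the elements $K_{\lambda,i}$ (so that the generalized characters are defined), and \[ \gamma^{\mu,j}_{(n-1,1),1}=\begin{cases} (-1)^k & \text{if } \mu=(n-k-1,2,1^{k-1}) \text{ and } j=2 \text{ for some } 1\le k\le n-3,\\ (-1)^k & \text{if } \mu=(n-k,1^k) \text{ and } j=n-k \text{ for some } 0\le k\le n-2,\\ (-1)^{k-1} & \text{if } \mu=(n-k,1^k) \text{ and } j=1 \text{ for some } 1\le k\le n-1,\\ 0 & \text{otherwise.} \end{cases} \] -/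

import Mathlib

noncomputable section

open scoped Classical

namespace NearCentral

/-! The symbols `1, …, n` permuted by `𝔖_n` are represented by the elements `0, …, n - 1` of `Fin n`. -/

/-- The complex group algebra of the symmetric group on `n` symbols. -/
abbrev GA (n : ℕ) : Type := MonoidAlgebra ℂ (Equiv.Perm (Fin n))

/-! ### Standard Young tableaux -/

/-- A standard Young tableau with `n` boxes (of any shape). It is recorded by the position
`pos i = (row, column)` of the box that carries the label `i`, rows and columns counted from `0`.
The set of occupied boxes is a Young diagram, and labels increase along rows and down columns. -/
@[ext]
structure SYT (n : ℕ) where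
  pos : Fin n → ℕ × ℕ
  injective : Function.Injective pos
  isLowerSet : IsLowerSet (Set.range pos)
  row_increasing : ∀ a b, (pos a).1 = (pos b).1 → (pos a).2 < (pos b).2 → a < b
  col_increasing : ∀ a b, (pos a).2 = (pos b).2 → (pos a).1 < (pos b).1 → a < b

namespace SYT

/-- A box weakly to the north-west of another one carries a smaller or equal label. -/
theorem le_of_pos_le {n : ℕ} (T : SYT n) {a b : Fin n} (h : T.pos a ≤ T.pos b) : a ≤ b := by
  obtain ⟨c, hc⟩ : ((T.pos a).1, (T.pos b).2) ∈ Set.range T.pos :=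
    T.isLowerSet (a := T.pos b) ⟨h.1, le_rfl⟩ ⟨b, rfl⟩
  have h1 : a ≤ c := by
    rcases h.2.eq_or_lt with h2 | h2
    · exact (T.injective (Prod.ext (by rw [hc]) (by rw [hc]; exact h2))).le
    · exact (T.row_increasing a c (by rw [hc]) (by rw [hc]; exact h2)).le
  have h3 : c ≤ b := by
    rcases h.1.eq_or_lt with h2 | h2
    · exact (T.injective (Prod.ext (by rw [hc]; exact h2) (by rw [hc]))).le
    · exact (T.col_increasing c b (by rw [hc]) (by rw [hc]; exact h2)).le
  exact h1.trans h3

/-- The Young diagram of the occupied boxes. -/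
def shape {n : ℕ} (T : SYT n) : YoungDiagram where
  cells := Finset.univ.image T.pos
  isLowerSet := by
    have h : ((Finset.univ.image T.pos : Finset (ℕ × ℕ)) : Set (ℕ × ℕ)) = Set.range T.pos := by
      simp
    rw [h]
    exact T.isLowerSet

/-- The tableau `T*` obtained from `T` by deleting the box with the largest label. -/
def star {n : ℕ} (T : SYT (n + 1)) : SYT n where
  pos i := T.pos i.castSucc
  injective _ _ h := Fin.castSucc_injective n (T.injective h)
  isLowerSet := by
    rintro _ b hb ⟨i, rfl⟩
    obtain ⟨j, rfl⟩ := T.isLowerSet hb ⟨i.castSucc, rfl⟩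
    have hj : j < Fin.last n := (T.le_of_pos_le hb).trans_lt (Fin.castSucc_lt_last i)
    exact ⟨j.castPred hj.ne, by simp⟩
  row_increasing a b h1 h2 := by simpa using T.row_increasing a.castSucc b.castSucc h1 h2
  col_increasing a b h1 h2 := by simpa using T.col_increasing a.castSucc b.castSucc h1 h2

theorem row_lt {n : ℕ} (T : SYT n) (i : Fin n) : (T.pos i).1 < n := by
  have h : ((Finset.range ((T.pos i).1 + 1)).image fun r => (r, (T.pos i).2)) ⊆
      Finset.univ.image T.pos := by
    intro x hx
    obtain ⟨r, hr, rfl⟩ := Finset.mem_image.1 hx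
    obtain ⟨c, hc⟩ : (r, (T.pos i).2) ∈ Set.range T.pos :=
      T.isLowerSet (a := T.pos i) ⟨Nat.lt_succ_iff.1 (Finset.mem_range.1 hr), le_rfl⟩ ⟨i, rfl⟩
    exact Finset.mem_image.2 ⟨c, Finset.mem_univ _, hc⟩
  have h2 := Finset.card_le_card h
  rw [Finset.card_image_of_injective _ (fun a b hab => (Prod.ext_iff.1 hab).1),
    Finset.card_image_of_injective _ T.injective] at h2
  simpa using h2

theorem col_lt {n : ℕ} (T : SYT n) (i : Fin n) : (T.pos i).2 < n := by
  have h : ((Finset.range ((T.pos i).2 + 1)).image fun r => ((T.pos i).1, r)) ⊆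
      Finset.univ.image T.pos := by
    intro x hx
    obtain ⟨r, hr, rfl⟩ := Finset.mem_image.1 hx
    obtain ⟨c, hc⟩ : ((T.pos i).1, r) ∈ Set.range T.pos :=
      T.isLowerSet (a := T.pos i) ⟨le_rfl, Nat.lt_succ_iff.1 (Finset.mem_range.1 hr)⟩ ⟨i, rfl⟩
    exact Finset.mem_image.2 ⟨c, Finset.mem_univ _, hc⟩
  have h2 := Finset.card_le_card h
  rw [Finset.card_image_of_injective _ (fun a b hab => (Prod.ext_iff.1 hab).2),
    Finset.card_image_of_injective _ T.injective] at h2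
  simpa using h2

instance instFiniteSYT (n : ℕ) : Finite (SYT n) :=
  Finite.of_injective
    (fun (T : SYT n) (i : Fin n) =>
      ((⟨(T.pos i).1, T.row_lt i⟩, ⟨(T.pos i).2, T.col_lt i⟩) : Fin n × Fin n))
    (by
      intro S T h
      ext i
      · simpa using congrArg (fun f => ((f i).1 : ℕ)) h
      · simpa using congrArg (fun f => ((f i).2 : ℕ)) h)

instance instFintypeSYT (n : ℕ) : Fintype (SYT n) := Fintype.ofFinite _

/-- `T` has shape the partition `μ`: the row lengths of its diagram are the parts of `μ`. -/
def HasShape {n : ℕ} (T : SYT n) (μ : n.Partition) : Prop :=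
  (T.shape.rowLens : Multiset ℕ) = μ.parts

/-- `T` belongs to `SYT_{μ,j}`: it has shape `μ`, and its largest label `n` (the element `x` of
`Fin n` with `x + 1 = n`) stands at the end of a row of length `j`. -/
def HasMarkedShape {n : ℕ} (T : SYT n) (μ : n.Partition) (j : ℕ) : Prop :=
  T.HasShape μ ∧ ∀ x : Fin n, (x : ℕ) + 1 = n →
    T.shape.rowLen (T.pos x).1 = j ∧ (T.pos x).2 + 1 = j

/-! ### Young's semi-normal units -/

/-- The row symmetrizer of `T`: the sum of all permutations that preserve every row of `T`. -/
def rowSymmetrizer {n : ℕ} (T : SYT n) : GA n :=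
  ∑ σ : Equiv.Perm (Fin n) with ∀ x, (T.pos (σ x)).1 = (T.pos x).1, MonoidAlgebra.single σ 1

/-- The column antisymmetrizer of `T`: the signed sum of all permutations that preserve every
column of `T`. -/
def colAntisymmetrizer {n : ℕ} (T : SYT n) : GA n :=
  ∑ σ : Equiv.Perm (Fin n) with ∀ x, (T.pos (σ x)).2 = (T.pos x).2,
    MonoidAlgebra.single σ (((Equiv.Perm.sign σ : ℤ) : ℂ))

end SYT

/-- The number of standard Young tableaux with `n` boxes and of shape the given Young diagram. -/
def numSYT (n : ℕ) (Y : YoungDiagram) : ℕ := Nat.card {T : SYT n // T.shape = Y}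

/-- The number `d_μ` of standard Young tableaux of shape `μ`, that is, the degree of the
irreducible representation indexed by `μ`. -/
def degree {n : ℕ} (μ : n.Partition) : ℕ := Nat.card {T : SYT n // T.HasShape μ}

/-- The inclusion of the group algebra of `𝔖_n`, as the permutations fixing the last symbol, into
that of `𝔖_{n+1}`. -/
def incl (n : ℕ) : GA n →ₐ[ℂ] GA (n + 1) :=
  MonoidAlgebra.mapDomainAlgHom ℂ ℂ
    (Equiv.Perm.viaEmbeddingHom (Fin.castSuccEmb : Fin n ↪ Fin (n + 1)))

/-- Young's semi-normal unit `e_T`, by Young's recursion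
`e_T = (d_λ / n!) • e_{T*} P_T N_T e_{T*}`, where `λ` is the shape of `T`, and `P_T`, `N_T` are its
row symmetrizer and column antisymmetrizer. -/
def semiNormalUnit : {n : ℕ} → SYT n → GA n
  | 0, _ => 1
  | n + 1, T =>
    ((numSYT (n + 1) T.shape : ℂ) / ((n + 1).factorial : ℂ)) •
      (incl n (semiNormalUnit T.star) * T.rowSymmetrizer * T.colAntisymmetrizer *
        incl n (semiNormalUnit T.star))

/-- `Γ^{μ,j}`, the sum of the semi-normal units `e_T` over `T` in `SYT_{μ,j}`. -/
def bigGamma {n : ℕ} (μ : n.Partition) (j : ℕ) : GA n :=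
  ∑ T : SYT n with T.HasMarkedShape μ j, semiNormalUnit T

/-! ### The standard basis of the centralizer, and generalized characters -/

/-- The class `𝒞_{ν,i}` of the permutations of cycle type `ν` in which the symbol `n` lies on a
cycle of length `i` (a fixed point is a cycle of length one). -/
def markedClass {n : ℕ} (ν : n.Partition) (i : ℕ) : Finset (Equiv.Perm (Fin n)) :=
  Finset.univ.filter fun π =>
    π.partition.parts = ν.parts ∧
      ∀ x : Fin n, (x : ℕ) + 1 = n → Function.minimalPeriod π x = i

/-- `K_{ν,i}`, the sum of the elements of `𝒞_{ν,i}`. -/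
def classSum {n : ℕ} (ν : n.Partition) (i : ℕ) : GA n :=
  ∑ π ∈ markedClass ν i, MonoidAlgebra.single π 1

/-- `a` is a family of coefficients of `g` in the elements `K_{ν,i}`, for `ν ⊢ n` and `i ∈ ν`. -/
def IsExpansion {n : ℕ} (g : GA n) (a : n.Partition → ℕ → ℂ) : Prop :=
  g = ∑ ν : n.Partition, ∑ i ∈ ν.parts.toFinset, a ν i • classSum ν i

/-- The coefficient `[K_{ν,i}] g` of `K_{ν,i}` in `g`, for `i ∈ ν` (and `0` by convention if `g` is
not a linear combination of the elements `K_{ν,i}`). -/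
def coeffK {n : ℕ} (ν : n.Partition) (i : ℕ) (g : GA n) : ℂ :=
  if h : ∃ a, IsExpansion g a then h.choose ν i else 0

/-- The generalized character `γ^{μ,j}_{ν,i} = (n! / d_μ) [K_{ν,i}] Γ^{μ,j}`. -/
def genChar {n : ℕ} (μ : n.Partition) (j : ℕ) (ν : n.Partition) (i : ℕ) : ℂ :=
  ((n.factorial : ℂ) / (degree μ : ℂ)) * coeffK ν i (bigGamma μ j)

/-! ### The partitions in the evaluation -/

/-- `(μ, j) = ((n-k-1, 2, 1^{k-1}), 2)`, where `1 ≤ k ≤ n - 3`. -/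
def IsNearHookTwo {n : ℕ} (μ : n.Partition) (j k : ℕ) : Prop :=
  1 ≤ k ∧ k + 3 ≤ n ∧ μ.parts = (n - k - 1) ::ₘ 2 ::ₘ Multiset.replicate (k - 1) 1 ∧ j = 2

/-- `(μ, j) = ((n-k, 1^k), n-k)`, where `0 ≤ k ≤ n - 2`. -/
def IsHookArm {n : ℕ} (μ : n.Partition) (j k : ℕ) : Prop :=
  k + 2 ≤ n ∧ μ.parts = (n - k) ::ₘ Multiset.replicate k 1 ∧ j = n - k

/-- `(μ, j) = ((n-k, 1^k), 1)`, where `1 ≤ k ≤ n - 1`. -/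
def IsHookLeg {n : ℕ} (μ : n.Partition) (j k : ℕ) : Prop :=
  1 ≤ k ∧ k + 1 ≤ n ∧ μ.parts = (n - k) ::ₘ Multiset.replicate k 1 ∧ j = 1

end NearCentral

end

/-!
The semi-normal units are the primitive idempotents of the Gelfand–Tsetlin basis, and `Γ^{μ,j}` is
the product of the central idempotent of the shape `μ` in `ℂ[𝔖_n]` with that of a shape `ρ` in
`ℂ[𝔖_{n-1}]`, where `ρ` is `μ` without the last box of the last row of length `j`. Hence `Γ^{μ,j}`
commutes with `𝔖_{n-1}`, which gives the expansion in the elements `K_{λ,i}` since the marked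
classes are the orbits of `𝔖_{n-1}` by conjugation (`exists_up_conj`). The generalized character at
`((n-1,1),1)` is the ordinary character of `ρ` at a cycle of length `n-1`, which is `(-1)^l` if `ρ`
is a hook with leg length `l`, and `0` otherwise; the cases of the statement are the three ways of
adding a box to a hook.

All of this is derived from the Jucys–Murphy elements `J_a = ∑_{b<a} (b a)`, without representation
theory. The sum of all transpositions is central and acts on `P_T N_T` by the sum of the contents
of `T`, because `P_T (a b) N_T = 0` if `a` and `b` share neither row nor column
(`SYT.sum_jm_mul_young`). By induction `e_T` is a joint eigenvector of the `J_a` from both sides,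
with the contents of `T` as eigenvalues. Exchanging consecutive labels by an intertwiner
(`IsJoint.exists_of_adj`) one reaches, from `e_T`, a nonzero joint eigenvector for each pair
`(S, T)` of tableaux of the same shape. They are linearly independent, since the contents determine a
tableau, and there are `n!` such pairs (`sum_numCells_shape`), so that they form a basis. It follows
that `1` is a sum of orthogonal idempotents `f_T`, proportional to `e_T`
(`exists_units_of_isJoint`), and that their sum over a shape is central (`shapeUnit_commute`).
The factor is `1`: the trace of the left multiplication by `f_T` shows that the coefficient of the
identity in `f_T` is `d / n!`, while that of `e_{T*} P_T N_T e_{T*}` is `1` by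
induction, as the part of `P_T N_T` in `ℂ[𝔖_{n-1}]` is `P_{T*} N_{T*}` (`semiNormalUnit_spec`).

Finally, the product of all `J_a` with `a` in `𝔖_{n-1}`, the first label excepted, consists of
`(n-2)!` cycles of length `n-1`, and it acts on `e_T` by the product of the contents of `T*`. That
product vanishes as soon as `T*` contains the second box of the main diagonal, and for hooks it
cancels against the number of tableaux (`factorial_mul_genChar`, `numCells_hook`).
-/

noncomputable section

open scoped Classical

namespace NearCentral

/-! ### Standard tableaux: contents and adjacent swaps -/

namespace SYT

variable {n : ℕ}

theorem mem_shape (T : SYT n) {b : ℕ × ℕ} : b ∈ T.shape ↔ ∃ i, T.pos i = b := by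
  rw [← YoungDiagram.mem_cells]
  simp [shape]

theorem card_cells_shape (T : SYT n) : T.shape.cells.card = n := by
  simp [shape, Finset.card_image_of_injective _ T.injective]

@[simp] theorem star_pos (T : SYT (n + 1)) (i : Fin n) : T.star.pos i = T.pos i.castSucc := rfl

theorem cells_shape_star (T : SYT (n + 1)) :
    T.shape.cells = insert (T.pos (Fin.last n)) T.star.shape.cells := by
  ext b
  rw [Finset.mem_insert, YoungDiagram.mem_cells, YoungDiagram.mem_cells, mem_shape, mem_shape,
    Fin.exists_fin_succ']
  simp [or_comm, eq_comm]

theorem last_notMem_star (T : SYT (n + 1)) : T.pos (Fin.last n) ∉ T.star.shape := by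
  rw [mem_shape]
  rintro ⟨i, hi⟩
  exact (Fin.castSucc_lt_last i).ne (T.injective hi)

/-- The box of the largest label is a corner. -/
theorem eq_last_of_le (T : SYT (n + 1)) {b : ℕ × ℕ} (hb : b ∈ T.shape)
    (h : T.pos (Fin.last n) ≤ b) : b = T.pos (Fin.last n) := by
  obtain ⟨i, rfl⟩ := T.mem_shape.1 hb
  rw [Fin.last_le_iff.1 (T.le_of_pos_le h)]

theorem ext_star {S T : SYT (n + 1)} (h : S.star = T.star)
    (hl : S.pos (Fin.last n) = T.pos (Fin.last n)) : S = T := by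
  apply SYT.ext
  funext i
  refine Fin.lastCases hl (fun i => ?_) i
  exact congrFun (congrArg SYT.pos h) i

/-- The content (column minus row) of the box that carries the label `a`. -/
def content (T : SYT n) (a : Fin n) : ℤ := (T.pos a).2 - (T.pos a).1

theorem content_star (T : SYT (n + 1)) (a : Fin n) : T.star.content a = T.content a.castSucc := rfl

/-- If `S* = T*` and the last boxes lie on the same diagonal, then the last box of `S` is not
strictly above that of `T`: otherwise it would belong to `T*`. -/
theorem le_row_of_content_eq {S T : SYT (n + 1)} (h : S.star = T.star)
    (hc : S.content (Fin.last n) = T.content (Fin.last n)) :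
    (T.pos (Fin.last n)).1 ≤ (S.pos (Fin.last n)).1 := by
  by_contra! hlt
  simp only [content] at hc
  have hle : S.pos (Fin.last n) ≤ T.pos (Fin.last n) := ⟨hlt.le, by omega⟩
  obtain ⟨i, hi⟩ := T.isLowerSet hle ⟨_, rfl⟩
  induction i using Fin.lastCases with
  | last => rw [hi] at hlt; exact lt_irrefl _ hlt
  | cast i =>
    have h1 : S.pos i.castSucc = S.pos (Fin.last n) := by
      rw [← hi]; exact congrFun (congrArg SYT.pos h) i
    exact (Fin.castSucc_lt_last i).ne (S.injective h1)

/-- A standard tableau is determined by its contents. -/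
theorem content_injective : Function.Injective (content : SYT n → Fin n → ℤ) := by
  induction n with
  | zero => intro S T _; apply SYT.ext; funext i; exact i.elim0
  | succ n ih =>
    intro S T h
    have hs : S.star = T.star := ih (funext fun a => congrFun h a.castSucc)
    have hl := congrFun h (Fin.last n)
    have h1 := le_antisymm (le_row_of_content_eq hs hl) (le_row_of_content_eq hs.symm hl.symm)
    refine ext_star hs (Prod.ext h1.symm ?_)
    simp only [content] at hl
    omega

/-- Consecutive labels in different rows and columns have contents that differ by at least `2`. -/
theorem two_le_abs_content_sub (T : SYT n) {i j : Fin n} (hij : (i : ℕ) + 1 = j)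
    (hr : (T.pos i).1 ≠ (T.pos j).1) (hc : (T.pos i).2 ≠ (T.pos j).2) :
    2 ≤ |T.content j - T.content i| := by
  rw [le_abs]
  simp only [content]
  rcases lt_or_gt_of_ne hr with h | h
  · have : (T.pos j).2 < (T.pos i).2 := by
      by_contra! hlt
      have hlt := lt_of_le_of_ne hlt hc
      obtain ⟨k, hk⟩ : ((T.pos i).1, (T.pos j).2) ∈ Set.range T.pos :=
        T.isLowerSet (a := T.pos j) ⟨h.le, le_rfl⟩ ⟨j, rfl⟩
      have h1 := T.row_increasing i k (by rw [hk]) (by rw [hk]; exact hlt)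
      have h2 := T.col_increasing k j (by rw [hk]) (by rw [hk]; exact h)
      omega
    omega
  · have : (T.pos i).2 < (T.pos j).2 := by
      by_contra! hlt
      have h1 := T.le_of_pos_le (a := j) (b := i) ⟨h.le, hlt⟩
      omega
    omega

theorem lt_of_swap_lt {i j a b : Fin n} (hij : (i : ℕ) + 1 = j)
    (h : Equiv.swap i j a < Equiv.swap i j b)
    (h' : ¬ (Equiv.swap i j a = i ∧ Equiv.swap i j b = j)) : a < b := by
  rw [Equiv.swap_apply_def, Equiv.swap_apply_def] at *
  split_ifs at * <;> simp_all <;> omega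

/-- The tableau obtained from `T` by exchanging two consecutive labels that are in different rows
and different columns. -/
def swapAdj (T : SYT n) (i j : Fin n) (hij : (i : ℕ) + 1 = j)
    (hr : (T.pos i).1 ≠ (T.pos j).1) (hc : (T.pos i).2 ≠ (T.pos j).2) : SYT n where
  pos a := T.pos (Equiv.swap i j a)
  injective := T.injective.comp (Equiv.injective _)
  isLowerSet := by
    have h : Set.range (fun a => T.pos (Equiv.swap i j a)) = Set.range T.pos :=
      (Equiv.swap i j).surjective.range_comp T.pos
    rw [h]
    exact T.isLowerSet
  row_increasing a b h1 h2 := lt_of_swap_lt hij (T.row_increasing _ _ h1 h2) (by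
    rintro ⟨h3, h4⟩
    rw [h3, h4] at h1
    exact hr h1)
  col_increasing a b h1 h2 := lt_of_swap_lt hij (T.col_increasing _ _ h1 h2) (by
    rintro ⟨h3, h4⟩
    rw [h3, h4] at h1
    exact hc h1)

/-- `T` arises from `S` by exchanging two consecutive labels that are in different rows and
columns. -/
def Adj (S T : SYT n) : Prop :=
  ∃ i j : Fin n, (i : ℕ) + 1 = j ∧ (S.pos i).1 ≠ (S.pos j).1 ∧ (S.pos i).2 ≠ (S.pos j).2 ∧
    ∀ a, T.pos a = S.pos (Equiv.swap i j a)

theorem Adj.shape_eq {S T : SYT n} (h : Adj S T) : T.shape = S.shape := by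
  obtain ⟨i, j, -, -, -, h⟩ := h
  ext b
  rw [YoungDiagram.mem_cells, YoungDiagram.mem_cells, mem_shape, mem_shape]
  simp only [h]
  exact (Equiv.swap i j).exists_congr_left.trans (by simp)

theorem shape_eq_of_reflTransGen {S T : SYT n} (h : Relation.ReflTransGen Adj S T) :
    T.shape = S.shape := by
  induction h with
  | refl => rfl
  | tail _ h ih => rw [h.shape_eq, ih]

/-- A chain of exchanges of the tableaux `T*` lifts to tableaux with one more box. -/
theorem exists_lift {S : SYT (n + 1)} {B : SYT n} (h : Relation.ReflTransGen Adj S.star B) :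
    ∃ T : SYT (n + 1), Relation.ReflTransGen Adj S T ∧ T.star = B ∧
      T.pos (Fin.last n) = S.pos (Fin.last n) := by
  induction h with
  | refl => exact ⟨S, .refl, rfl, rfl⟩
  | @tail B C _ hBC ih =>
    obtain ⟨T, hST, rfl, hl⟩ := ih
    obtain ⟨i, j, hij, hr, hc, hp⟩ := hBC
    have hne : ∀ k : Fin n, Fin.last n ≠ k.castSucc := fun k => (Fin.castSucc_lt_last k).ne'
    refine ⟨T.swapAdj i.castSucc j.castSucc hij hr hc, hST.tail
      ⟨i.castSucc, j.castSucc, hij, hr, hc, fun a => rfl⟩, ?_, ?_⟩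
    · apply SYT.ext
      funext a
      rw [hp]
      simp only [star_pos, swapAdj]
      congr 1
      simp only [Equiv.swap_apply_def, Fin.castSucc_inj]
      split_ifs <;> rfl
    · rw [← hl]
      simp only [swapAdj]
      rw [Equiv.swap_apply_of_ne_of_ne (hne i) (hne j)]

/-- The largest label can be moved to any corner. -/
theorem exists_last_eq (S : SYT (n + 1)) {b : ℕ × ℕ} (hb : b ∈ S.shape)
    (h1 : ∀ c ∈ S.shape, b ≤ c → c = b) :
    ∃ T, Relation.ReflTransGen Adj S T ∧ T.pos (Fin.last n) = b := by
  induction n with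
  | zero =>
    obtain ⟨i, hi⟩ := S.mem_shape.1 hb
    refine ⟨S, .refl, ?_⟩
    rw [← hi, show i = Fin.last 0 from Fin.ext (by omega)]
  | succ n ih =>
    by_cases hbl : S.pos (Fin.last (n + 1)) = b
    · exact ⟨S, .refl, hbl⟩
    have hsub : ∀ c ∈ S.star.shape, c ∈ S.shape := fun c hc => by
      rw [← YoungDiagram.mem_cells, cells_shape_star]
      exact Finset.mem_insert_of_mem hc
    have hb' : b ∈ S.star.shape := by
      rw [← YoungDiagram.mem_cells, cells_shape_star, Finset.mem_insert] at hb
      exact hb.resolve_left (Ne.symm hbl)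
    obtain ⟨A, hA, hAl⟩ := ih S.star hb' (fun c hc => h1 c (hsub c hc))
    obtain ⟨U, hSU, rfl, hUl⟩ := exists_lift hA
    have hlS := S.mem_shape.2 ⟨Fin.last (n + 1), rfl⟩
    have hi : U.pos (Fin.last n).castSucc = b := hAl
    -- Two different corners lie neither in the same row nor in the same column.
    have key : ∀ c ∈ S.shape, b ≤ c ∨ c ≤ b → c = S.pos (Fin.last (n + 1)) → False := by
      rintro c hc (h | h) rfl
      · exact hbl (h1 _ hc h)
      · exact hbl (S.eq_last_of_le hb h).symm
    have hr : (U.pos (Fin.last n).castSucc).1 ≠ (U.pos (Fin.last (n + 1))).1 := by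
      rw [hi, hUl]
      intro h
      refine key _ hlS ?_ rfl
      rcases le_total b.2 (S.pos (Fin.last (n + 1))).2 with h2 | h2
      · exact .inl ⟨h.le, h2⟩
      · exact .inr ⟨h.ge, h2⟩
    have hc : (U.pos (Fin.last n).castSucc).2 ≠ (U.pos (Fin.last (n + 1))).2 := by
      rw [hi, hUl]
      intro h
      refine key _ hlS ?_ rfl
      rcases le_total b.1 (S.pos (Fin.last (n + 1))).1 with h2 | h2
      · exact .inl ⟨h2, h.le⟩
      · exact .inr ⟨h2, h.ge⟩
    refine ⟨U.swapAdj (Fin.last n).castSucc (Fin.last (n + 1)) (by simp) hr hc,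
      hSU.tail ⟨_, _, by simp, hr, hc, fun a => rfl⟩, ?_⟩
    simp only [swapAdj]
    rw [Equiv.swap_apply_right, hi]

theorem shape_star_eq {S T : SYT (n + 1)} (h : S.shape = T.shape)
    (hl : S.pos (Fin.last n) = T.pos (Fin.last n)) : S.star.shape = T.star.shape := by
  have h1 := cells_shape_star S
  rw [h, cells_shape_star T, hl] at h1
  apply YoungDiagram.ext
  rw [← Finset.erase_insert (show T.pos (Fin.last n) ∉ T.star.shape.cells from T.last_notMem_star),
    h1, Finset.erase_insert (hl ▸ S.last_notMem_star)]

/-- Any two standard tableaux of the same shape are connected by exchanges of consecutive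
labels. -/
theorem reflTransGen_adj_of_shape_eq {S T : SYT n} (h : S.shape = T.shape) :
    Relation.ReflTransGen Adj S T := by
  induction n with
  | zero =>
    have : S = T := SYT.ext (funext fun i => i.elim0)
    exact this ▸ .refl
  | succ n ih =>
    obtain ⟨U, hSU, hUl⟩ := S.exists_last_eq (b := T.pos (Fin.last n))
      (h ▸ T.mem_shape.2 ⟨_, rfl⟩) (fun c hc hle => T.eq_last_of_le (h ▸ hc) hle)
    have hU := shape_eq_of_reflTransGen hSU
    obtain ⟨V, hUV, hVT, hVl⟩ := exists_lift (ih (shape_star_eq (hU.trans h) hUl))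
    rw [← ext_star hVT (hVl.trans hUl)]
    exact hSU.trans hUV

/-! ### Adding a box, and the number of pairs of tableaux of the same shape -/

/-- The tableau obtained from `T` by adding the box `a` with the next label. -/
def snoc (T : SYT n) (a : ℕ × ℕ) (ha : a ∉ T.shape)
    (hl : IsLowerSet (insert a (T.shape.cells : Set (ℕ × ℕ)))) : SYT (n + 1) where
  pos := Fin.snoc (α := fun _ => ℕ × ℕ) T.pos a
  injective := by
    intro i j
    rw [mem_shape] at ha
    push Not at ha
    refine Fin.lastCases ?_ (fun i => ?_) i <;> refine Fin.lastCases ?_ (fun j => ?_) j <;>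
      simp [ha, Ne.symm (ha _), T.injective.eq_iff]
  isLowerSet := by
    have h : Set.range (Fin.snoc (α := fun _ => ℕ × ℕ) T.pos a) =
        insert a (T.shape.cells : Set (ℕ × ℕ)) := by
      ext b
      simp only [Set.mem_range, Fin.exists_fin_succ', Fin.snoc_castSucc, Fin.snoc_last,
        Set.mem_insert_iff, Finset.mem_coe, YoungDiagram.mem_cells, mem_shape]
      tauto
    rw [h]
    exact hl
  row_increasing i j := by
    refine Fin.lastCases ?_ (fun i => ?_) i <;> refine Fin.lastCases ?_ (fun j => ?_) j
    · simp
    · simp only [Fin.snoc_last, Fin.snoc_castSucc]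
      intro h1 h2
      exact absurd (T.shape.isLowerSet (a := T.pos j) (b := a) ⟨h1.le, h2.le⟩
        (T.mem_shape.2 ⟨j, rfl⟩)) ha
    · exact fun _ _ => Fin.castSucc_lt_last i
    · simpa using T.row_increasing i j
  col_increasing i j := by
    refine Fin.lastCases ?_ (fun i => ?_) i <;> refine Fin.lastCases ?_ (fun j => ?_) j
    · simp
    · simp only [Fin.snoc_last, Fin.snoc_castSucc]
      intro h1 h2
      exact absurd (T.shape.isLowerSet (a := T.pos j) (b := a) ⟨h2.le, h1.le⟩
        (T.mem_shape.2 ⟨j, rfl⟩)) ha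
    · exact fun _ _ => Fin.castSucc_lt_last i
    · simpa using T.col_increasing i j

@[simp] theorem snoc_star (T : SYT n) (a ha hl) : (T.snoc a ha hl).star = T := by
  apply SYT.ext
  funext i
  simp [snoc]

@[simp] theorem snoc_last (T : SYT n) (a ha hl) : (T.snoc a ha hl).pos (Fin.last n) = a := by
  simp [snoc]

end SYT

/-- The boxes that can be added to `C`. The bound on the coordinates only serves finiteness. -/
def addable (C : Finset (ℕ × ℕ)) : Finset (ℕ × ℕ) :=
  (Finset.range (C.card + 1) ×ˢ Finset.range (C.card + 1)).filter fun a =>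
    a ∉ C ∧ IsLowerSet ((insert a C : Finset (ℕ × ℕ)) : Set (ℕ × ℕ))

theorem mem_addable {C : Finset (ℕ × ℕ)} {a : ℕ × ℕ} :
    a ∈ addable C ↔ a ∉ C ∧ IsLowerSet ((insert a C : Finset (ℕ × ℕ)) : Set (ℕ × ℕ)) := by
  simp only [addable, Finset.mem_filter, Finset.mem_product, Finset.mem_range,
    and_iff_right_iff_imp]
  rintro ⟨h1, h2⟩
  have ha : a ∈ ((insert a C : Finset (ℕ × ℕ)) : Set (ℕ × ℕ)) := by simp
  have key : ∀ f : ℕ → ℕ × ℕ, Function.Injective f → ∀ m, (∀ r < m, f r ≤ a ∧ f r ≠ a) →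
      m < C.card + 1 := by
    intro f hf m h
    have hsub : (Finset.range m).image f ⊆ C := by
      intro x hx
      obtain ⟨r, hr, rfl⟩ := Finset.mem_image.1 hx
      obtain ⟨h3, h4⟩ := h r (Finset.mem_range.1 hr)
      exact (Finset.mem_insert.1 (Finset.mem_coe.1 (h2 h3 ha))).resolve_left h4
    have := Finset.card_le_card hsub
    rw [Finset.card_image_of_injective _ hf, Finset.card_range] at this
    omega
  constructor
  · refine key (fun r => (r, a.2)) (fun x y h => (Prod.ext_iff.1 h).1) a.1 fun r hr => ?_
    exact ⟨⟨hr.le, le_rfl⟩, fun h => hr.ne (congrArg Prod.fst h)⟩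
  · refine key (fun r => (a.1, r)) (fun x y h => (Prod.ext_iff.1 h).2) a.2 fun r hr => ?_
    exact ⟨⟨le_rfl, hr.le⟩, fun h => hr.ne (congrArg Prod.snd h)⟩

/-- The boxes that can be removed from `C`. -/
def removable (C : Finset (ℕ × ℕ)) : Finset (ℕ × ℕ) :=
  C.filter fun c => IsLowerSet ((C.erase c : Finset (ℕ × ℕ)) : Set (ℕ × ℕ))

theorem mem_addable_cells {Y : YoungDiagram} {a : ℕ × ℕ} :
    a ∈ addable Y.cells ↔ a.2 = Y.rowLen a.1 ∧ ∀ i, a.1 = i + 1 → a.2 < Y.rowLen i := by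
  rw [mem_addable, YoungDiagram.mem_cells]
  obtain ⟨r, c⟩ := a
  rw [YoungDiagram.mem_iff_lt_rowLen]
  constructor
  · rintro ⟨h1, h2⟩
    have ha : (r, c) ∈ ((insert (r, c) Y.cells : Finset (ℕ × ℕ)) : Set (ℕ × ℕ)) := by simp
    have key : ∀ b : ℕ × ℕ, b ≤ (r, c) → b ≠ (r, c) → b ∈ Y := by
      intro b hb hne
      exact (Finset.mem_insert.1 (Finset.mem_coe.1 (h2 hb ha))).resolve_left hne
    refine ⟨?_, fun i hi => ?_⟩
    · by_contra hne
      have := key (r, Y.rowLen r) ⟨le_rfl, by simp only; omega⟩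
        fun h => hne (congrArg Prod.snd h).symm
      rw [YoungDiagram.mem_iff_lt_rowLen] at this
      exact lt_irrefl _ this
    · simp only at hi
      have := key (i, c) ⟨by simp only; omega, le_rfl⟩ fun h => by
        have := congrArg Prod.fst h
        simp only at this
        omega
      rwa [YoungDiagram.mem_iff_lt_rowLen] at this
  · simp only
    rintro ⟨h1, h2⟩
    refine ⟨by omega, ?_⟩
    rintro y ⟨x1, x2⟩ hx hy
    simp only [Finset.coe_insert, Set.mem_insert_iff, Finset.mem_coe, YoungDiagram.mem_cells]
      at hy ⊢
    rcases hy with rfl | hy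
    · obtain ⟨h3, h4⟩ := hx
      simp only at h3 h4
      rw [YoungDiagram.mem_iff_lt_rowLen, Prod.mk.injEq]
      rcases h3.eq_or_lt with rfl | h3
      · omega
      · right
        obtain ⟨i, rfl⟩ : ∃ i, r = i + 1 := ⟨r - 1, by omega⟩
        have := h2 i rfl
        have := Y.rowLen_anti x1 i (by omega)
        omega
    · exact .inr (Y.isLowerSet hx hy)

theorem mem_removable_cells {Y : YoungDiagram} {c : ℕ × ℕ} :
    c ∈ removable Y.cells ↔ c.2 + 1 = Y.rowLen c.1 ∧ Y.rowLen (c.1 + 1) ≤ c.2 := by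
  obtain ⟨r, c⟩ := c
  simp only [removable, Finset.mem_filter, YoungDiagram.mem_cells]
  constructor
  · rintro ⟨h1, h2⟩
    have key : ∀ b : ℕ × ℕ, (r, c) ≤ b → b ≠ (r, c) → b ∉ Y := by
      intro b hb hne hbY
      have := h2 hb (Finset.mem_coe.2 (Finset.mem_erase.2 ⟨hne, hbY⟩))
      simp at this
    have h3 := key (r + 1, c) ⟨by simp, le_rfl⟩ (by simp)
    have h4 := key (r, c + 1) ⟨le_rfl, by simp⟩ (by simp)
    rw [YoungDiagram.mem_iff_lt_rowLen] at h1 h3 h4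
    omega
  · rintro ⟨h1, h2⟩
    refine ⟨YoungDiagram.mem_iff_lt_rowLen.2 (by omega), ?_⟩
    intro y x hx hy
    simp only [Finset.coe_erase, Set.mem_sdiff, Finset.mem_coe, YoungDiagram.mem_cells,
      Set.mem_singleton_iff] at hy ⊢
    refine ⟨Y.isLowerSet hx hy.1, ?_⟩
    rintro rfl
    obtain ⟨y1, y2⟩ := y
    obtain ⟨h3, h4⟩ := hx
    simp only at h3 h4
    rw [YoungDiagram.mem_iff_lt_rowLen, Prod.mk.injEq] at hy
    rcases h3.eq_or_lt with rfl | h3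
    · omega
    · have := Y.rowLen_anti (r + 1) y1 h3
      omega

/-- A Young diagram has one addable box more than it has removable boxes. -/
theorem card_addable (Y : YoungDiagram) :
    (addable Y.cells).card = (removable Y.cells).card + 1 := by
  have h : addable Y.cells = insert (0, Y.rowLen 0)
      ((removable Y.cells).image fun c => (c.1 + 1, Y.rowLen (c.1 + 1))) := by
    ext ⟨r, c⟩
    simp only [Finset.mem_insert, Finset.mem_image, mem_addable_cells, mem_removable_cells,
      Prod.mk.injEq, Prod.exists]
    constructor
    · rintro ⟨h1, h2⟩
      cases r with
      | zero => exact .inl ⟨rfl, h1⟩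
      | succ r =>
        have := h2 r rfl
        exact .inr ⟨r, Y.rowLen r - 1, by omega, rfl, h1.symm⟩
    · rintro (⟨rfl, rfl⟩ | ⟨r, c, h, rfl, rfl⟩)
      · exact ⟨rfl, fun i hi => by omega⟩
      · refine ⟨rfl, fun i hi => ?_⟩
        obtain rfl : r = i := by omega
        omega
  rw [h, Finset.card_insert_of_notMem (by simp), Finset.card_image_of_injOn]
  rintro ⟨r, c⟩ h1 ⟨r', c'⟩ h2 h3
  rw [Finset.mem_coe, mem_removable_cells] at h1 h2
  simp only [Prod.mk.injEq] at h1 h2 h3 ⊢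
  obtain rfl : r = r' := by omega
  omega

/-- The number of standard tableaux with `n` boxes that occupy exactly the set `C` of boxes. -/
def numCells (n : ℕ) (C : Finset (ℕ × ℕ)) : ℕ :=
  (Finset.univ.filter fun T : SYT n => T.shape.cells = C).card

theorem numCells_eq_zero {n : ℕ} {C : Finset (ℕ × ℕ)} (h : ¬ IsLowerSet (C : Set (ℕ × ℕ))) :
    numCells n C = 0 := by
  rw [numCells, Finset.card_eq_zero, Finset.filter_eq_empty_iff]
  rintro T - rfl
  exact h T.shape.isLowerSet

/-- Tableaux with a prescribed last box correspond to tableaux with that box deleted. -/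
theorem card_star_eq {n : ℕ} {C : Finset (ℕ × ℕ)} {a : ℕ × ℕ} (ha : a ∉ C)
    (hl : IsLowerSet ((insert a C : Finset (ℕ × ℕ)) : Set (ℕ × ℕ))) :
    (Finset.univ.filter fun T : SYT (n + 1) =>
      T.star.shape.cells = C ∧ T.pos (Fin.last n) = a).card = numCells n C := by
  refine Finset.card_bij (fun T _ => T.star) ?_ ?_ ?_
  · intro T hT
    simp only [Finset.mem_filter, Finset.mem_univ, true_and] at hT ⊢
    exact hT.1
  · intro S hS T hT h
    simp only [Finset.mem_filter, Finset.mem_univ, true_and] at hS hT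
    exact SYT.ext_star h (hS.2.trans hT.2.symm)
  · intro S hS
    simp only [Finset.mem_filter, Finset.mem_univ, true_and] at hS
    subst hS
    exact ⟨S.snoc a ha (by simpa using hl), by simp, by simp⟩

/-- The branching rule for the number of standard tableaux. -/
theorem numCells_succ {n : ℕ} (Y : YoungDiagram) :
    numCells (n + 1) Y.cells = ∑ c ∈ Y.cells, numCells n (Y.cells.erase c) := by
  rw [numCells, Finset.card_eq_sum_card_fiberwise (f := fun T : SYT (n + 1) => T.pos (Fin.last n))
    (t := Y.cells)]
  · refine Finset.sum_congr rfl fun c hc => ?_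
    rw [← card_star_eq (a := c) (Finset.notMem_erase c Y.cells)
      (by rw [Finset.insert_erase hc]; exact Y.isLowerSet), Finset.filter_filter]
    congr 1
    ext T
    simp only [Finset.mem_filter, Finset.mem_univ, true_and]
    refine and_congr_left fun h => ?_
    have h1 : c ∉ T.star.shape.cells := h ▸ T.last_notMem_star
    rw [SYT.cells_shape_star, h]
    constructor
    · intro h2
      rw [← h2, Finset.erase_insert h1]
    · intro h2
      rw [h2, Finset.insert_erase hc]
  · intro T hT
    simp only [Finset.coe_filter, Finset.mem_univ, true_and, Set.mem_ofPred_eq] at hT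
    rw [← hT]
    exact T.mem_shape.2 ⟨_, rfl⟩

theorem isLowerSet_erase_of_insert {C : Finset (ℕ × ℕ)} {a c : ℕ × ℕ}
    (hC : IsLowerSet (C : Set (ℕ × ℕ))) (ha : a ∉ C)
    (h : IsLowerSet ((insert a (C.erase c) : Finset (ℕ × ℕ)) : Set (ℕ × ℕ))) :
    IsLowerSet ((C.erase c : Finset (ℕ × ℕ)) : Set (ℕ × ℕ)) := by
  have : ((C.erase c : Finset (ℕ × ℕ)) : Set (ℕ × ℕ)) =
      (C : Set (ℕ × ℕ)) ∩ ((insert a (C.erase c) : Finset (ℕ × ℕ)) : Set (ℕ × ℕ)) := by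
    rw [← Finset.coe_inter, Finset.inter_insert_of_notMem ha,
      Finset.inter_eq_right.2 (Finset.erase_subset _ _)]
  rw [this]
  exact hC.inter h

/-- After a removable box `c` is deleted from `Y`, the box `c` can be added back, and the other
addable boxes that matter are those of `Y`. -/
theorem sum_addable_erase {n : ℕ} (Y : YoungDiagram) {c : ℕ × ℕ} (hc : c ∈ removable Y.cells) :
    ∑ a ∈ addable (Y.cells.erase c), numCells n (insert a (Y.cells.erase c)) =
      (∑ a ∈ addable Y.cells, numCells n (insert a (Y.cells.erase c))) + numCells n Y.cells := by
  obtain ⟨hcY, hlow⟩ := Finset.mem_filter.1 hc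
  have hca : c ∈ addable (Y.cells.erase c) := by
    rw [mem_addable, Finset.insert_erase hcY]
    exact ⟨Finset.notMem_erase _ _, Y.isLowerSet⟩
  rw [← Finset.sum_erase_add _ _ hca, Finset.insert_erase hcY]
  congr 1
  refine Finset.sum_subset ?_ ?_
  · intro a ha
    obtain ⟨hne, ha⟩ := Finset.mem_erase.1 ha
    obtain ⟨h1, h2⟩ := mem_addable.1 ha
    have h3 : a ∉ Y.cells := fun h => h1 (Finset.mem_erase.2 ⟨hne, h⟩)
    refine mem_addable.2 ⟨h3, ?_⟩
    have : ((insert a Y.cells : Finset (ℕ × ℕ)) : Set (ℕ × ℕ)) =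
        (Y.cells : Set (ℕ × ℕ)) ∪
          ((insert a (Y.cells.erase c) : Finset (ℕ × ℕ)) : Set (ℕ × ℕ)) := by
      rw [← Finset.coe_union, Finset.union_insert, Finset.union_eq_left.2 (Finset.erase_subset _ _)]
    rw [this]
    exact Y.isLowerSet.union h2
  · intro a ha hna
    obtain ⟨h1, -⟩ := mem_addable.1 ha
    refine numCells_eq_zero fun h => hna (Finset.mem_erase.2 ⟨?_, mem_addable.2 ⟨?_, h⟩⟩)
    · rintro rfl
      exact h1 hcY
    · exact fun h => h1 (Finset.mem_of_mem_erase h)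

theorem card_eq_of_numCells_ne_zero {n : ℕ} {C : Finset (ℕ × ℕ)} (h : numCells n C ≠ 0) :
    C.card = n := by
  obtain ⟨T, hT⟩ := Finset.card_ne_zero.1 h
  rw [← (Finset.mem_filter.1 hT).2, T.card_cells_shape]

theorem sum_addable_numCells_succ (m : ℕ) (Y : YoungDiagram) :
    ∑ a ∈ addable Y.cells, numCells (m + 1) (insert a Y.cells) =
      (addable Y.cells).card * numCells m Y.cells +
        ∑ c ∈ removable Y.cells, ∑ a ∈ addable Y.cells,
          numCells m (insert a (Y.cells.erase c)) := by
  have h1 : ∀ a ∈ addable Y.cells, numCells (m + 1) (insert a Y.cells) =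
      numCells m Y.cells + ∑ c ∈ removable Y.cells, numCells m (insert a (Y.cells.erase c)) := by
    intro a ha
    obtain ⟨h1, h2⟩ := mem_addable.1 ha
    have h3 := numCells_succ (n := m) ⟨insert a Y.cells, h2⟩
    simp only at h3
    rw [h3, Finset.sum_insert h1, Finset.erase_insert h1]
    congr 1
    rw [removable, Finset.sum_filter]
    refine Finset.sum_congr rfl fun c hc => ?_
    have hne : a ≠ c := fun h => h1 (h ▸ hc)
    rw [Finset.erase_insert_of_ne hne]
    split_ifs with h
    · rfl
    · exact numCells_eq_zero fun h4 => h (isLowerSet_erase_of_insert Y.isLowerSet h1 h4)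
  rw [Finset.sum_congr rfl h1, Finset.sum_add_distrib, Finset.sum_const, smul_eq_mul,
    Finset.sum_comm]

/-- The dual branching rule: the number of standard tableaux whose shape is a given shape with one
box added. -/
theorem sum_addable_numCells (n : ℕ) (Y : YoungDiagram) :
    ∑ a ∈ addable Y.cells, numCells (n + 1) (insert a Y.cells) = (n + 1) * numCells n Y.cells := by
  induction n generalizing Y with
  | zero =>
    rw [sum_addable_numCells_succ, card_addable, Finset.sum_eq_zero, add_zero]
    · by_cases h : numCells 0 Y.cells = 0
      · simp [h]
      · have h0 : removable Y.cells = ∅ := by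
          rw [removable, Finset.card_eq_zero.1 (card_eq_of_numCells_ne_zero h), Finset.filter_empty]
        simp [h0]
    · intro c _
      refine Finset.sum_eq_zero fun a _ => ?_
      by_contra h
      have := card_eq_of_numCells_ne_zero h
      simp at this
  | succ n ih =>
    have h1 : ∑ c ∈ removable Y.cells, numCells n (Y.cells.erase c) = numCells (n + 1) Y.cells := by
      rw [numCells_succ, removable, Finset.sum_filter]
      refine Finset.sum_congr rfl fun c _ => ?_
      split_ifs with h
      · rfl
      · exact (numCells_eq_zero h).symm
    have h2 : (∑ c ∈ removable Y.cells, ∑ a ∈ addable Y.cells,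
        numCells (n + 1) (insert a (Y.cells.erase c))) +
        (removable Y.cells).card * numCells (n + 1) Y.cells =
        (n + 1) * numCells (n + 1) Y.cells := by
      rw [← smul_eq_mul, ← Finset.sum_const, ← Finset.sum_add_distrib, ← h1, Finset.mul_sum]
      refine Finset.sum_congr rfl fun c hc => ?_
      rw [h1, ← sum_addable_erase Y hc]
      exact ih ⟨Y.cells.erase c, (Finset.mem_filter.1 hc).2⟩
    rw [sum_addable_numCells_succ, card_addable]
    linarith

/-- There are `n!` pairs of standard tableaux with `n` boxes and the same shape. -/
theorem sum_numCells_shape (n : ℕ) : ∑ T : SYT n, numCells n T.shape.cells = n.factorial := by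
  induction n with
  | zero =>
    have hT : ∀ S T : SYT 0, S = T := fun S T => SYT.ext (funext fun i => i.elim0)
    let T₀ : SYT 0 :=
      ⟨fun i => i.elim0, fun i => i.elim0, by simp [isLowerSet_empty],
        fun i => i.elim0, fun i => i.elim0⟩
    have : (Finset.univ : Finset (SYT 0)) = {T₀} := by
      ext T
      simp [hT T T₀]
    rw [this, Finset.sum_singleton, numCells, this]
    simp [hT _ T₀]
  | succ n ih =>
    rw [Nat.factorial_succ, ← ih, Finset.mul_sum,
      ← Finset.sum_fiberwise_of_maps_to (g := SYT.star) (t := Finset.univ) (by simp)]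
    refine Finset.sum_congr rfl fun S _ => ?_
    rw [← sum_addable_numCells]
    refine Finset.sum_bij (fun T _ => T.pos (Fin.last n)) ?_ ?_ ?_ ?_
    · intro T hT
      obtain rfl := (Finset.mem_filter.1 hT).2
      refine mem_addable.2 ⟨T.last_notMem_star, ?_⟩
      rw [← SYT.cells_shape_star]
      exact T.shape.isLowerSet
    · intro T hT U hU h
      exact SYT.ext_star ((Finset.mem_filter.1 hT).2.trans (Finset.mem_filter.1 hU).2.symm) h
    · intro a ha
      obtain ⟨h1, h2⟩ := mem_addable.1 ha
      exact ⟨S.snoc a h1 (by simpa using h2), by simp, by simp⟩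
    · intro T hT
      obtain rfl := (Finset.mem_filter.1 hT).2
      rw [SYT.cells_shape_star]

theorem numSYT_eq_numCells (n : ℕ) (Y : YoungDiagram) : numSYT n Y = numCells n Y.cells := by
  rw [numSYT, Nat.card_eq_fintype_card, Fintype.card_subtype, numCells]
  congr 1
  ext T
  simp [YoungDiagram.ext_iff]

/-! ### The group algebra and its Jucys–Murphy elements -/

section GroupAlgebra

variable {n : ℕ}

/-- The element of the group algebra given by a permutation. -/
abbrev grp (σ : Equiv.Perm (Fin n)) : GA n := MonoidAlgebra.single σ 1

theorem grp_mul (σ τ : Equiv.Perm (Fin n)) : grp σ * grp τ = grp (σ * τ) := by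
  simp [grp]

theorem grp_one : grp (1 : Equiv.Perm (Fin n)) = 1 := rfl

theorem eq_sum_grp (x : GA n) : x = ∑ σ, x.coeff σ • grp σ := by
  ext τ
  simp [MonoidAlgebra.coeff_sum]

/-- An additive property of elements of the group algebra may be checked on permutations. -/
theorem induction_grp {p : GA n → Prop} (x : GA n) (h0 : p 0) (hadd : ∀ x y, p x → p y → p (x + y))
    (hs : ∀ (c : ℂ) σ, p (c • grp σ)) : p x := by
  rw [eq_sum_grp x]
  exact Finset.sum_induction _ p hadd h0 fun σ _ => hs _ σ

theorem coeff_one_mul_comm (x y : GA n) : (x * y).coeff 1 = (y * x).coeff 1 := by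
  induction x using induction_grp with
  | h0 => simp
  | hadd a b ha hb => simp [add_mul, mul_add, ha, hb]
  | hs c σ => simp [mul_comm]

/-- The trace of a left multiplication in the group algebra. -/
theorem trace_mulLeft (x : GA n) :
    LinearMap.trace ℂ (GA n) (LinearMap.mulLeft ℂ x) = n.factorial * x.coeff 1 := by
  rw [LinearMap.trace_eq_matrix_trace ℂ (MonoidAlgebra.basis (Equiv.Perm (Fin n)) ℂ), Matrix.trace]
  have h : ∀ σ : Equiv.Perm (Fin n), (LinearMap.toMatrix (MonoidAlgebra.basis _ ℂ)
      (MonoidAlgebra.basis _ ℂ) (LinearMap.mulLeft ℂ x)).diag σ = x.coeff 1 := by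
    intro σ
    rw [Matrix.diag_apply, LinearMap.toMatrix_apply]
    simp [MonoidAlgebra.basis]
  rw [Finset.sum_congr rfl fun σ _ => h σ]
  simp [Fintype.card_perm]

theorem finrank_GA : Module.finrank ℂ (GA n) = n.factorial := by
  rw [Module.finrank_eq_card_basis (MonoidAlgebra.basis (Equiv.Perm (Fin n)) ℂ), Fintype.card_perm,
    Fintype.card_fin]

/-- The Jucys–Murphy element of the label `a`. -/
def jm (a : Fin n) : GA n := ∑ b : Fin n with b < a, grp (Equiv.swap b a)

theorem grp_mul_jm (σ : Equiv.Perm (Fin n)) {a : Fin n} (ha : σ a = a)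
    (hσ : ∀ b, σ b < a ↔ b < a) : grp σ * jm a = jm a * grp σ := by
  rw [jm, Finset.mul_sum, Finset.sum_mul]
  refine Finset.sum_equiv σ (by simp [hσ]) fun b _ => ?_
  rw [grp_mul, grp_mul, Equiv.mul_swap_eq_swap_mul, ha]

theorem swap_mul_jm {i j a : Fin n} (h : i < a ∧ j < a ∨ a < i ∧ a < j) :
    grp (Equiv.swap i j) * jm a = jm a * grp (Equiv.swap i j) := by
  refine grp_mul_jm _ (Equiv.swap_apply_of_ne_of_ne ?_ ?_) fun b => ?_
  · rintro rfl; simp at h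
  · rintro rfl; simp at h
  · rw [Equiv.swap_apply_def]
    split_ifs with h1 h2
    · subst h1; rcases h with h | h <;> simp [h.1, h.2, h.1.not_gt, h.2.not_gt]
    · subst h2; rcases h with h | h <;> simp [h.1, h.2, h.1.not_gt, h.2.not_gt]
    · rfl

theorem jm_commute (a b : Fin n) : Commute (jm a) (jm b) := by
  wlog h : a ≤ b generalizing a b
  · exact (this b a (le_of_not_ge h)).symm
  rcases h.eq_or_lt with rfl | h
  · exact Commute.refl _
  rw [jm]
  refine Commute.sum_left _ _ _ fun c hc => ?_
  exact swap_mul_jm (.inl ⟨(Finset.mem_filter.1 hc).2.trans h, h⟩)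

theorem jm_succ {i j : Fin n} (hij : (i : ℕ) + 1 = j) :
    jm j = grp (Equiv.swap i j) + ∑ b : Fin n with b < i, grp (Equiv.swap b j) := by
  have : (Finset.univ.filter fun b : Fin n => b < j) =
      insert i (Finset.univ.filter fun b : Fin n => b < i) := by
    ext b
    simp only [Finset.mem_filter, Finset.mem_univ, true_and, Finset.mem_insert, Fin.lt_def,
      Fin.ext_iff]
    omega
  rw [jm, this, Finset.sum_insert (by simp)]

theorem swap_mul_jm_succ {i j : Fin n} (hij : (i : ℕ) + 1 = j) :
    grp (Equiv.swap i j) * jm j = jm i * grp (Equiv.swap i j) + 1 := by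
  rw [jm_succ hij, mul_add, grp_mul, Equiv.swap_mul_self, grp_one, add_comm, jm, Finset.mul_sum,
    Finset.sum_mul]
  congr 1
  refine Finset.sum_congr rfl fun b hb => ?_
  have hb := (Finset.mem_filter.1 hb).2
  rw [grp_mul, grp_mul, Equiv.mul_swap_eq_swap_mul, Equiv.swap_apply_right,
    Equiv.swap_apply_of_ne_of_ne hb.ne (by rintro rfl; have := Fin.lt_def.1 hb; omega)]

theorem jm_succ_mul_swap {i j : Fin n} (hij : (i : ℕ) + 1 = j) :
    jm j * grp (Equiv.swap i j) = grp (Equiv.swap i j) * jm i + 1 := by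
  have hs : grp (Equiv.swap i j) * grp (Equiv.swap i j) = 1 := by
    rw [grp_mul, Equiv.swap_mul_self, grp_one]
  calc jm j * grp (Equiv.swap i j)
      = grp (Equiv.swap i j) * (grp (Equiv.swap i j) * jm j) * grp (Equiv.swap i j) := by
        rw [← mul_assoc, hs, one_mul]
    _ = _ := by
        rw [swap_mul_jm_succ hij, mul_add, add_mul, mul_one, hs, mul_assoc, mul_assoc, hs, mul_one]

/-- The sum of all Jucys–Murphy elements, that is, of all transpositions, is central. -/
theorem sum_jm_commute (x : GA n) : Commute (∑ a : Fin n, jm a) x := by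
  -- Summed over all ordered pairs, the transpositions are visibly permuted by conjugation.
  have h2 : (2 : ℂ) • ∑ a : Fin n, jm a =
      (∑ a : Fin n, ∑ b : Fin n, grp (Equiv.swap b a)) - (n : ℂ) • 1 := by
    have h : ∀ a b : Fin n, grp (Equiv.swap b a) = (if b < a then grp (Equiv.swap b a) else 0) +
        (if a < b then grp (Equiv.swap a b) else 0) + if b = a then 1 else 0 := by
      intro a b
      rcases lt_trichotomy b a with h | rfl | h
      · simp [h, h.ne, h.not_gt]
      · simp [grp_one, Equiv.swap_self, ← Equiv.Perm.one_def]
      · simp [h, h.ne', h.not_gt, Equiv.swap_comm b a]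
    rw [Finset.sum_congr rfl fun a _ => Finset.sum_congr rfl fun b _ => h a b]
    simp only [Finset.sum_add_distrib, Finset.sum_ite_eq', Finset.mem_univ,
      if_true, Finset.sum_const, Finset.card_univ, Fintype.card_fin]
    rw [Finset.sum_comm (f := fun a b => if a < b then grp (Equiv.swap a b) else 0)]
    simp only [← Finset.sum_filter]
    change _ = ∑ a : Fin n, jm a + ∑ a : Fin n, jm a + _ - _
    rw [two_smul, Nat.cast_smul_eq_nsmul, add_sub_cancel_right]
  have h3 : Commute (∑ a : Fin n, ∑ b : Fin n, grp (Equiv.swap b a)) x := by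
    induction x using induction_grp with
    | h0 => exact Commute.zero_right _
    | hadd a b ha hb => exact ha.add_right hb
    | hs c σ =>
      refine Commute.smul_right ?_ c
      rw [Commute, SemiconjBy, Finset.sum_mul, Finset.mul_sum, ← Equiv.sum_comp σ]
      refine Finset.sum_congr rfl fun a _ => ?_
      rw [Finset.sum_mul, Finset.mul_sum, ← Equiv.sum_comp σ]
      refine Finset.sum_congr rfl fun b _ => ?_
      rw [grp_mul, grp_mul, Equiv.mul_swap_eq_swap_mul]
  have h4 : ∑ a : Fin n, jm a = (2⁻¹ : ℂ) •
      ((∑ a : Fin n, ∑ b : Fin n, grp (Equiv.swap b a)) - (n : ℂ) • 1) := by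
    rw [← h2, smul_smul, inv_mul_cancel₀ two_ne_zero, one_smul]
  rw [h4]
  exact (h3.sub_left ((Commute.one_left x).smul_left _)).smul_left _

/-! ### The inclusion of the symmetric group fixing the last symbol -/

/-- A permutation of `n` symbols as a permutation of `n + 1` symbols that fixes the last one. -/
abbrev up : Equiv.Perm (Fin n) →* Equiv.Perm (Fin (n + 1)) :=
  Equiv.Perm.viaEmbeddingHom (Fin.castSuccEmb : Fin n ↪ Fin (n + 1))

theorem up_castSucc (σ : Equiv.Perm (Fin n)) (a : Fin n) : up σ a.castSucc = (σ a).castSucc :=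
  Equiv.Perm.viaEmbedding_apply σ Fin.castSuccEmb a

theorem up_last (σ : Equiv.Perm (Fin n)) : up σ (Fin.last n) = Fin.last n :=
  Equiv.Perm.viaEmbedding_apply_of_notMem σ Fin.castSuccEmb _ (by
    rintro ⟨a, ha⟩
    exact (Fin.castSucc_lt_last a).ne ha)

theorem up_injective : Function.Injective (up : Equiv.Perm (Fin n) → Equiv.Perm (Fin (n + 1))) :=
  Equiv.Perm.viaEmbeddingHom_injective _

theorem sign_up (σ : Equiv.Perm (Fin n)) : Equiv.Perm.sign (up σ) = Equiv.Perm.sign σ := by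
  rw [up, Equiv.Perm.viaEmbeddingHom_apply, Equiv.Perm.viaEmbedding]
  convert Equiv.Perm.sign_extendDomain σ _

theorem cycleType_up (σ : Equiv.Perm (Fin n)) : (up σ).cycleType = σ.cycleType := by
  rw [up, Equiv.Perm.viaEmbeddingHom_apply, Equiv.Perm.viaEmbedding]
  convert Equiv.Perm.cycleType_extendDomain _

theorem eq_up {τ : Equiv.Perm (Fin (n + 1))} {σ : Equiv.Perm (Fin n)}
    (h : ∀ a : Fin n, τ a.castSucc = (σ a).castSucc) : τ = up σ := by
  have h1 : ∀ a : Fin n, τ a.castSucc = up σ a.castSucc := fun a =>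
    (h a).trans (up_castSucc σ a).symm
  refine Equiv.ext (Fin.lastCases ?_ h1)
  rw [up_last]
  by_contra hne
  obtain ⟨a, ha⟩ := Fin.exists_castSucc_eq.2 hne
  have h2 : τ (σ.symm a).castSucc = τ (Fin.last n) := by rw [h, Equiv.apply_symm_apply, ha]
  exact (Fin.castSucc_lt_last _).ne (τ.injective h2)

theorem exists_up_eq {τ : Equiv.Perm (Fin (n + 1))} (h : τ (Fin.last n) = Fin.last n) :
    ∃ σ, up σ = τ := by
  have h1 : ∀ a : Fin n, ∃ b : Fin n, b.castSucc = τ a.castSucc := fun a => by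
    rw [Fin.exists_castSucc_eq, ← h]
    exact fun h2 => (Fin.castSucc_lt_last a).ne (τ.injective h2)
  choose f hf using h1
  have hinj : Function.Injective f := fun a b hab => by
    have := hf a
    rw [hab, hf] at this
    exact (Fin.castSucc_injective n (τ.injective this)).symm
  refine ⟨Equiv.ofBijective f (Finite.injective_iff_bijective.1 hinj), (eq_up fun a => ?_).symm⟩
  exact (hf a).symm

theorem up_swap (a b : Fin n) : up (Equiv.swap a b) = Equiv.swap a.castSucc b.castSucc := by
  refine (eq_up fun c => ?_).symm
  simp only [Equiv.swap_apply_def, Fin.castSucc_inj]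
  split_ifs <;> rfl

theorem incl_grp (σ : Equiv.Perm (Fin n)) : incl n (grp σ) = grp (up σ) := by
  simp [incl]

theorem incl_jm (a : Fin n) : incl n (jm a) = jm a.castSucc := by
  simp only [jm, Finset.sum_filter, map_sum]
  rw [Fin.sum_univ_castSucc, if_neg (Fin.castSucc_lt_last a).not_gt, add_zero]
  refine Finset.sum_congr rfl fun b _ => ?_
  simp only [Fin.castSucc_lt_castSucc_iff]
  split_ifs
  · rw [incl_grp, up_swap]
  · exact map_zero _

end GroupAlgebra

/-! ### Young symmetrizers -/

namespace SYT

variable {n : ℕ}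

/-- The Young symmetrizer `P_T N_T`. -/
def young (T : SYT n) : GA n := T.rowSymmetrizer * T.colAntisymmetrizer

theorem rowSymmetrizer_mul_swap (T : SYT n) {a b : Fin n} (h : (T.pos a).1 = (T.pos b).1) :
    T.rowSymmetrizer * grp (Equiv.swap a b) = T.rowSymmetrizer := by
  have hs : ∀ x, (T.pos (Equiv.swap a b x)).1 = (T.pos x).1 := fun x => by
    rw [Equiv.swap_apply_def]
    split_ifs with h1 h2
    · rw [h1, h]
    · rw [h2, h]
    · rfl
  rw [rowSymmetrizer, Finset.sum_mul]
  refine Finset.sum_equiv (Equiv.mulRight (Equiv.swap a b)) (fun σ => ?_) fun σ _ => by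
    rw [grp_mul]; rfl
  simp only [Finset.mem_filter, Finset.mem_univ, true_and, Equiv.coe_mulRight,
    Equiv.Perm.mul_apply]
  constructor
  · intro h x
    rw [h, hs]
  · intro h x
    have := h (Equiv.swap a b x)
    rwa [Equiv.swap_apply_self, hs] at this

theorem swap_mul_colAntisymmetrizer (T : SYT n) {a b : Fin n} (h : (T.pos a).2 = (T.pos b).2)
    (hab : a ≠ b) :
    grp (Equiv.swap a b) * T.colAntisymmetrizer = -T.colAntisymmetrizer := by
  have hs : ∀ x, (T.pos (Equiv.swap a b x)).2 = (T.pos x).2 := fun x => by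
    rw [Equiv.swap_apply_def]
    split_ifs with h1 h2
    · rw [h1, h]
    · rw [h2, h]
    · rfl
  rw [colAntisymmetrizer, Finset.mul_sum, ← Finset.sum_neg_distrib]
  refine Finset.sum_equiv (Equiv.mulLeft (Equiv.swap a b)) (fun σ => ?_) fun σ _ => ?_
  · simp only [Finset.mem_filter, Finset.mem_univ, true_and, Equiv.coe_mulLeft,
      Equiv.Perm.mul_apply, hs]
  · simp [Equiv.Perm.sign_swap hab, ← MonoidAlgebra.single_neg]

theorem row_mul_swap_mul_col_of_lt (T : SYT n) {a b : Fin n} (hr : (T.pos a).1 < (T.pos b).1)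
    (hc : (T.pos a).2 ≠ (T.pos b).2) :
    T.rowSymmetrizer * grp (Equiv.swap a b) * T.colAntisymmetrizer = 0 := by
  obtain ⟨c, hcp⟩ : ((T.pos a).1, (T.pos b).2) ∈ Set.range T.pos :=
    T.isLowerSet (a := T.pos b) ⟨hr.le, le_rfl⟩ ⟨b, rfl⟩
  have hca : c ≠ a := fun h => hc (by rw [← h, hcp])
  have hcb : c ≠ b := fun h => hr.ne (by rw [← h, hcp])
  have h1 : grp (Equiv.swap a b) * grp (Equiv.swap b c) =
      grp (Equiv.swap a c) * grp (Equiv.swap a b) := by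
    rw [grp_mul, grp_mul, Equiv.mul_swap_eq_swap_mul, Equiv.swap_apply_right,
      Equiv.swap_apply_of_ne_of_ne hca hcb]
  have h2 := congrArg (fun x => T.rowSymmetrizer * x * T.colAntisymmetrizer) h1
  rw [← mul_assoc T.rowSymmetrizer (grp (Equiv.swap a c)),
    T.rowSymmetrizer_mul_swap (by rw [hcp]), ← mul_assoc, mul_assoc (_ * _),
    T.swap_mul_colAntisymmetrizer (by rw [hcp]) hcb.symm, mul_neg] at h2
  have h3 : (2 : ℂ) • (T.rowSymmetrizer * grp (Equiv.swap a b) * T.colAntisymmetrizer) = 0 := by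
    rw [two_smul, add_eq_zero_iff_neg_eq, h2]
  exact (smul_eq_zero.1 h3).resolve_left two_ne_zero

/-- A transposition of labels that share neither row nor column is annihilated between the row and
the column symmetrizer. -/
theorem row_mul_swap_mul_col (T : SYT n) {a b : Fin n} (hr : (T.pos a).1 ≠ (T.pos b).1)
    (hc : (T.pos a).2 ≠ (T.pos b).2) :
    T.rowSymmetrizer * grp (Equiv.swap a b) * T.colAntisymmetrizer = 0 := by
  rcases lt_or_gt_of_ne hr with h | h
  · exact T.row_mul_swap_mul_col_of_lt h hc
  · rw [Equiv.swap_comm]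
    exact T.row_mul_swap_mul_col_of_lt h hc.symm

theorem card_row_lt (T : SYT n) (a : Fin n) :
    (Finset.univ.filter fun b => b < a ∧ (T.pos b).1 = (T.pos a).1).card = (T.pos a).2 := by
  rw [← Finset.card_range (T.pos a).2]
  refine Finset.card_bij (fun b _ => (T.pos b).2) ?_ ?_ ?_
  · intro b hb
    obtain ⟨h1, h2⟩ := (Finset.mem_filter.1 hb).2
    rw [Finset.mem_range]
    by_contra! h
    exact absurd (T.le_of_pos_le (a := a) (b := b) ⟨h2.ge, h⟩) h1.not_ge
  · intro b hb c hc h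
    exact T.injective (Prod.ext
      ((Finset.mem_filter.1 hb).2.2.trans (Finset.mem_filter.1 hc).2.2.symm) h)
  · intro k hk
    obtain ⟨b, hb⟩ : ((T.pos a).1, k) ∈ Set.range T.pos :=
      T.isLowerSet (a := T.pos a) ⟨le_rfl, (Finset.mem_range.1 hk).le⟩ ⟨a, rfl⟩
    refine ⟨b, Finset.mem_filter.2 ⟨Finset.mem_univ _, ?_, by rw [hb]⟩, by rw [hb]⟩
    exact T.row_increasing b a (by rw [hb]) (by rw [hb]; exact Finset.mem_range.1 hk)

theorem card_col_lt (T : SYT n) (a : Fin n) :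
    (Finset.univ.filter fun b => b < a ∧ (T.pos b).2 = (T.pos a).2).card = (T.pos a).1 := by
  rw [← Finset.card_range (T.pos a).1]
  refine Finset.card_bij (fun b _ => (T.pos b).1) ?_ ?_ ?_
  · intro b hb
    obtain ⟨h1, h2⟩ := (Finset.mem_filter.1 hb).2
    rw [Finset.mem_range]
    by_contra! h
    exact absurd (T.le_of_pos_le (a := a) (b := b) ⟨h, h2.ge⟩) h1.not_ge
  · intro b hb c hc h
    exact T.injective (Prod.ext h
      ((Finset.mem_filter.1 hb).2.2.trans (Finset.mem_filter.1 hc).2.2.symm))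
  · intro k hk
    obtain ⟨b, hb⟩ : (k, (T.pos a).2) ∈ Set.range T.pos :=
      T.isLowerSet (a := T.pos a) ⟨(Finset.mem_range.1 hk).le, le_rfl⟩ ⟨a, rfl⟩
    refine ⟨b, Finset.mem_filter.2 ⟨Finset.mem_univ _, ?_, by rw [hb]⟩, by rw [hb]⟩
    exact T.col_increasing b a (by rw [hb]) (by rw [hb]; exact Finset.mem_range.1 hk)

theorem row_mul_jm_mul_col (T : SYT n) (a : Fin n) :
    T.rowSymmetrizer * jm a * T.colAntisymmetrizer = (T.content a : ℂ) • T.young := by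
  have h : ∀ b : Fin n, b < a →
      T.rowSymmetrizer * grp (Equiv.swap b a) * T.colAntisymmetrizer =
        (if (T.pos b).1 = (T.pos a).1 then T.young else 0) -
          (if (T.pos b).2 = (T.pos a).2 then T.young else 0) := by
    intro b hb
    by_cases h1 : (T.pos b).1 = (T.pos a).1
    · have h2 : (T.pos b).2 ≠ (T.pos a).2 := fun h2 => hb.ne (T.injective (Prod.ext h1 h2))
      rw [if_pos h1, if_neg h2, T.rowSymmetrizer_mul_swap h1, sub_zero, young]
    · by_cases h2 : (T.pos b).2 = (T.pos a).2
      · rw [if_neg h1, if_pos h2, mul_assoc, T.swap_mul_colAntisymmetrizer h2 hb.ne, zero_sub,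
          mul_neg, young]
      · rw [if_neg h1, if_neg h2, T.row_mul_swap_mul_col h1 h2, sub_zero]
  rw [jm, Finset.mul_sum, Finset.sum_mul,
    Finset.sum_congr rfl fun b hb => h b (Finset.mem_filter.1 hb).2, Finset.sum_sub_distrib,
    ← Finset.sum_filter, ← Finset.sum_filter, Finset.filter_filter, Finset.filter_filter,
    Finset.sum_const, Finset.sum_const, card_row_lt, card_col_lt, content,
    ← Nat.cast_smul_eq_nsmul ℂ, ← Nat.cast_smul_eq_nsmul ℂ, ← sub_smul]
  push_cast
  rfl

/-- The sum of all transpositions acts on a Young symmetrizer by the sum of the contents. -/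
theorem sum_jm_mul_young (T : SYT n) :
    (∑ a, jm a) * T.young = (∑ a, (T.content a : ℂ)) • T.young := by
  rw [young, ← mul_assoc, (sum_jm_commute T.rowSymmetrizer).eq, Finset.mul_sum, Finset.sum_mul,
    Finset.sum_congr rfl fun a _ => T.row_mul_jm_mul_col a, ← Finset.sum_smul, young]

theorem coeff_young (T : SYT n) (g : Equiv.Perm (Fin n)) :
    T.young.coeff g = ∑ x : Equiv.Perm (Fin n) × Equiv.Perm (Fin n) with
      (∀ a, (T.pos (x.1 a)).1 = (T.pos a).1) ∧ (∀ a, (T.pos (x.2 a)).2 = (T.pos a).2) ∧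
        x.1 * x.2 = g, ((Equiv.Perm.sign x.2 : ℤ) : ℂ) := by
  rw [young, rowSymmetrizer, colAntisymmetrizer, Finset.sum_mul_sum, ← Finset.sum_product',
    MonoidAlgebra.coeff_sum, Finsupp.finsetSum_apply]
  simp only [MonoidAlgebra.single_mul_single, one_mul, MonoidAlgebra.coeff_single,
    Finsupp.single_apply]
  rw [← Finset.sum_filter]
  refine Finset.sum_congr ?_ fun _ _ => rfl
  ext x
  simp [and_assoc]

/-- The part of the Young symmetrizer of `T` that fixes the last symbol is that of `T*`: a
permutation of the rows after one of the columns fixes the last symbol only if both do. -/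
theorem coeff_young_up (T : SYT (n + 1)) (σ : Equiv.Perm (Fin n)) :
    T.young.coeff (up σ) = T.star.young.coeff σ := by
  rw [coeff_young, coeff_young]
  symm
  refine Finset.sum_bij (fun x _ => (up x.1, up x.2)) ?_ ?_ ?_ ?_
  · rintro ⟨p, q⟩ hx
    simp only [Finset.mem_filter, Finset.mem_univ, true_and] at hx ⊢
    obtain ⟨h1, h2, rfl⟩ := hx
    refine ⟨?_, ?_, (map_mul up p q).symm⟩
    · refine Fin.lastCases (by rw [up_last]) fun a => ?_
      rw [up_castSucc]
      exact h1 a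
    · refine Fin.lastCases (by rw [up_last]) fun a => ?_
      rw [up_castSucc]
      exact h2 a
  · rintro ⟨p, q⟩ - ⟨p', q'⟩ - h
    simp only [Prod.mk.injEq] at h
    exact Prod.ext (up_injective h.1) (up_injective h.2)
  · rintro ⟨p, q⟩ hx
    simp only [Finset.mem_filter, Finset.mem_univ, true_and] at hx
    obtain ⟨h1, h2, h3⟩ := hx
    have h4 : p (q (Fin.last n)) = Fin.last n := by
      rw [← Equiv.Perm.mul_apply, h3, up_last]
    have hq : q (Fin.last n) = Fin.last n := by
      refine T.injective (Prod.ext ?_ (h2 _))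
      rw [← h1 (q (Fin.last n)), h4]
    rw [hq] at h4
    obtain ⟨p, rfl⟩ := exists_up_eq h4
    obtain ⟨q, rfl⟩ := exists_up_eq hq
    refine ⟨(p, q), ?_, rfl⟩
    simp only [Finset.mem_filter, Finset.mem_univ, true_and]
    refine ⟨fun a => ?_, fun a => ?_, up_injective (by rw [← h3, map_mul])⟩
    · have := h1 a.castSucc
      rwa [up_castSucc] at this
    · have := h2 a.castSucc
      rwa [up_castSucc] at this
  · rintro ⟨p, q⟩ -
    simp only [sign_up]

theorem coeff_one_incl_mul_young (T : SYT (n + 1)) (z : GA n) :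
    (incl n z * T.young).coeff 1 = (z * T.star.young).coeff 1 := by
  induction z using induction_grp with
  | h0 => simp
  | hadd a b ha hb =>
    simp only [map_add, add_mul, MonoidAlgebra.coeff_add, Finsupp.add_apply, ha, hb]
  | hs c σ =>
    rw [map_smul, incl_grp]
    simp only [smul_mul_assoc, MonoidAlgebra.coeff_smul, Finsupp.smul_apply,
      MonoidAlgebra.coeff_single_mul_apply, mul_one, ← map_inv, coeff_young_up]

end SYT

/-! ### Joint eigenvectors of the Jucys–Murphy elements -/

section Joint

variable {n : ℕ}

/-- `x` is a joint eigenvector of the Jucys–Murphy elements, with the contents of `S` as left and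
the contents of `T` as right eigenvalues. -/
def IsJoint (S T : SYT n) (x : GA n) : Prop :=
  ∀ a, jm a * x = (S.content a : ℂ) • x ∧ x * jm a = (T.content a : ℂ) • x

theorem IsJoint.smul {S T : SYT n} {x : GA n} (h : IsJoint S T x) (c : ℂ) :
    IsJoint S T (c • x) := fun a => by
  rw [mul_smul_comm, smul_mul_assoc, (h a).1, (h a).2, smul_comm c, smul_comm c]
  exact ⟨rfl, rfl⟩

theorem IsJoint.mul {S T S' T' : SYT n} {x y : GA n} (hx : IsJoint S S' x)
    (hy : IsJoint T' T y) (g : GA n) : IsJoint S T (x * g * y) := fun a => by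
  refine ⟨?_, ?_⟩
  · rw [← mul_assoc, ← mul_assoc, (hx a).1, smul_mul_assoc, smul_mul_assoc]
  · rw [mul_assoc, (hy a).2, mul_smul_comm]

theorem exists_content_ne {S T : SYT n} (h : S ≠ T) : ∃ a, (S.content a : ℂ) ≠ T.content a := by
  by_contra! h1
  exact h (SYT.content_injective (funext fun a => by exact_mod_cast h1 a))

theorem IsJoint.mul_eq_zero {S T S' T' : SYT n} {x y : GA n} (hx : IsJoint S S' x)
    (hy : IsJoint T T' y) (h : S' ≠ T) : x * y = 0 := by
  obtain ⟨a, ha⟩ := exists_content_ne h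
  have h1 : x * jm a * y = x * (jm a * y) := mul_assoc _ _ _
  rw [(hx a).2, (hy a).1, smul_mul_assoc, mul_smul_comm, ← sub_eq_zero, ← sub_smul] at h1
  exact (smul_eq_zero.1 h1).resolve_left (sub_ne_zero.2 ha)

/-- The intertwiner `s - 1/r`, for the transposition `s` of consecutive labels `i, j` with content
difference `r`, exchanges the eigenvalues of the Jucys–Murphy elements of `i` and `j`. It is
injective because `|r| ≥ 2`. -/
theorem IsJoint.exists_of_adj {S S' T : SYT n} (hS : SYT.Adj S S') {x : GA n} (hx : x ≠ 0)
    (h : IsJoint S T x) : ∃ y, y ≠ 0 ∧ IsJoint S' T y := by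
  obtain ⟨i, j, hij, hr, hc, hp⟩ := hS
  have hcont : ∀ a, S'.content a = S.content (Equiv.swap i j a) := fun a => by
    simp only [SYT.content, hp]
  have habs := S.two_le_abs_content_sub hij hr hc
  have hlt : i < j := Fin.lt_def.2 (by omega)
  set r : ℤ := S.content j - S.content i with hrdef
  have hr0 : (r : ℂ) ≠ 0 := by
    rw [Int.cast_ne_zero]
    rintro h0
    rw [h0] at habs
    norm_num at habs
  have hr2 : (r : ℂ) * r ≠ 1 := by
    intro h0
    have h1 : r * r = 1 := by exact_mod_cast h0
    rw [← abs_mul_abs_self] at h1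
    nlinarith
  have hcj : (S.content j : ℂ) = r + S.content i := by rw [hrdef]; push_cast; ring
  have hss : grp (Equiv.swap i j) * grp (Equiv.swap i j) = 1 := by
    rw [grp_mul, Equiv.swap_mul_self, grp_one]
  refine ⟨grp (Equiv.swap i j) * x - (r : ℂ)⁻¹ • x, ?_, fun a => ⟨?_, ?_⟩⟩
  · intro h0
    have h1 := sub_eq_zero.1 h0
    have h2 : x = ((r : ℂ)⁻¹ * (r : ℂ)⁻¹) • x := by
      calc x = grp (Equiv.swap i j) * (grp (Equiv.swap i j) * x) := by
            rw [← mul_assoc, hss, one_mul]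
        _ = _ := by rw [h1, mul_smul_comm, h1, smul_smul]
    have h3 : (1 - (r : ℂ)⁻¹ * (r : ℂ)⁻¹) • x = 0 := by
      rw [sub_smul, one_smul, ← h2, sub_self]
    rcases smul_eq_zero.1 h3 with h4 | h4
    · apply hr2
      field_simp at h4
      linear_combination h4
    · exact hx h4
  · rw [hcont, mul_sub, mul_smul_comm]
    by_cases hai : a = i
    · subst hai
      have h5 : jm a * grp (Equiv.swap a j) = grp (Equiv.swap a j) * jm j - 1 := by
        rw [swap_mul_jm_succ hij, add_sub_cancel_right]
      rw [Equiv.swap_apply_left, ← mul_assoc, h5, sub_mul, mul_assoc, (h j).1, (h a).1, one_mul,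
        mul_smul_comm, hcj]
      match_scalars
      · ring
      · field_simp
        ring
    by_cases haj : a = j
    · subst haj
      rw [Equiv.swap_apply_right, ← mul_assoc, jm_succ_mul_swap hij, add_mul, mul_assoc, (h i).1,
        (h a).1, one_mul, mul_smul_comm, hcj]
      match_scalars
      · ring
      · field_simp
        ring
    · rw [Equiv.swap_apply_of_ne_of_ne hai haj, ← mul_assoc, ← swap_mul_jm, mul_assoc, (h a).1,
        mul_smul_comm, smul_sub, smul_comm (r : ℂ)⁻¹]
      rcases lt_or_gt_of_ne hai with h1 | h1
      · exact .inr ⟨h1, h1.trans hlt⟩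
      · refine .inl ⟨h1, lt_of_le_of_ne ?_ (Ne.symm haj)⟩
        rw [Fin.lt_def] at h1
        rw [Fin.le_def]
        omega
  · rw [sub_mul, mul_assoc, smul_mul_assoc, (h a).2, mul_smul_comm, smul_sub,
      smul_comm (r : ℂ)⁻¹]

theorem IsJoint.exists_of_shape_eq {S T : SYT n} (hS : S.shape = T.shape) {x : GA n} (hx : x ≠ 0)
    (h : IsJoint T T x) : ∃ y, y ≠ 0 ∧ IsJoint S T y := by
  induction SYT.reflTransGen_adj_of_shape_eq hS.symm with
  | refl => exact ⟨x, hx, h⟩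
  | @tail U V hU hUV ih =>
    obtain ⟨y, hy, hy'⟩ := ih (SYT.shape_eq_of_reflTransGen hU)
    exact hy'.exists_of_adj hUV hy

/-- The pairs of standard tableaux of the same shape. -/
abbrev ShapePair (n : ℕ) : Type := {p : SYT n × SYT n // p.1.shape = p.2.shape}

theorem card_shapePair_fst (T : SYT n) :
    (Finset.univ.filter fun p : ShapePair n => p.1.1 = T).card = numCells n T.shape.cells := by
  rw [numCells]
  refine Finset.card_bij (fun p _ => p.1.2) ?_ ?_ ?_
  · intro p hp
    obtain rfl := (Finset.mem_filter.1 hp).2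
    exact Finset.mem_filter.2 ⟨Finset.mem_univ _, by rw [p.2]⟩
  · intro p hp q hq h
    exact Subtype.ext (Prod.ext
      ((Finset.mem_filter.1 hp).2.trans (Finset.mem_filter.1 hq).2.symm) h)
  · intro S hS
    exact ⟨⟨(T, S), (YoungDiagram.ext (Finset.mem_filter.1 hS).2).symm⟩, by simp, rfl⟩

theorem card_shapePair : Fintype.card (ShapePair n) = n.factorial := by
  rw [← sum_numCells_shape, ← Finset.card_univ,
    Finset.card_eq_sum_card_fiberwise (f := fun p : ShapePair n => p.1.1) (t := Finset.univ)
      (by simp)]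
  exact Finset.sum_congr rfl fun T _ => card_shapePair_fst T

theorem linearIndependent_of_joint_eigenvectors {V ι κ : Type*} [AddCommGroup V] [Module ℂ V]
    {f : ι → Module.End ℂ V} (hf : ∀ i j, Commute (f i) (f j)) {χ : κ → ι → ℂ}
    (hχ : Function.Injective χ) {w : κ → V} (hw : ∀ p, w p ≠ 0)
    (h : ∀ p i, f i (w p) = χ p i • w p) : LinearIndependent ℂ w := by
  have hind := (Module.End.independent_iInf_maxGenEigenspace_of_forall_mapsTo f
    fun i j φ => Module.End.mapsTo_maxGenEigenspace_of_comm (hf j i) φ).comp hχ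
  refine hind.linearIndependent _ (fun p => ?_) hw
  simp only [Function.comp_apply, Submodule.mem_iInf]
  exact fun i => Module.End.eigenspace_le_maxGenEigenspace (Module.End.mem_eigenspace_iff.2 (h p i))

/-- Joint eigenvectors for different pairs of tableaux are linearly independent. -/
theorem linearIndependent_of_isJoint {w : ShapePair n → GA n} (hw : ∀ p, w p ≠ 0)
    (h : ∀ p, IsJoint p.1.1 p.1.2 (w p)) : LinearIndependent ℂ w := by
  let f : Fin n ⊕ Fin n → Module.End ℂ (GA n) :=
    Sum.elim (fun a => LinearMap.mulLeft ℂ (jm a)) (fun a => LinearMap.mulRight ℂ (jm a))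
  have hf : ∀ i j, Commute (f i) (f j) := by
    have h1 : ∀ a b, Commute (LinearMap.mulLeft ℂ (jm (n := n) a))
        (LinearMap.mulRight ℂ (jm (n := n) b)) := fun a b =>
      LinearMap.ext fun x => by simp [mul_assoc]
    rintro (a | a) (b | b)
    · refine LinearMap.ext fun x => ?_
      simp [f, ← mul_assoc, (jm_commute a b).eq]
    · exact h1 a b
    · exact (h1 b a).symm
    · refine LinearMap.ext fun x => ?_
      simp [f, mul_assoc, (jm_commute a b).eq]
  let χ : ShapePair n → (Fin n ⊕ Fin n → ℂ) := fun p =>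
    Sum.elim (fun a => (p.1.1.content a : ℂ)) (fun a => (p.1.2.content a : ℂ))
  have hχ : Function.Injective χ := by
    intro p q hpq
    refine Subtype.ext (Prod.ext ?_ ?_)
    · by_contra hne
      obtain ⟨a, ha⟩ := exists_content_ne hne
      exact ha (congrFun hpq (.inl a))
    · by_contra hne
      obtain ⟨a, ha⟩ := exists_content_ne hne
      exact ha (congrFun hpq (.inr a))
  refine linearIndependent_of_joint_eigenvectors hf hχ hw ?_
  rintro p (a | a)
  · exact (h p a).1
  · exact (h p a).2

/-- If every standard tableau has a joint eigenvector, then the group algebra decomposes into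
one-dimensional joint eigenspaces indexed by the pairs of tableaux of the same shape, and `1` into
idempotents indexed by the tableaux. -/
theorem exists_units_of_isJoint (H : ∀ T : SYT n, ∃ x, x ≠ 0 ∧ IsJoint T T x) :
    (∀ (S T : SYT n) (x : GA n), S.shape ≠ T.shape → IsJoint S T x → x = 0) ∧
    ∃ f : SYT n → GA n, ∑ T, f T = 1 ∧ (∀ T, IsJoint T T (f T)) ∧ (∀ T, f T * f T = f T) ∧
      (∀ T x, IsJoint T T x → ∃ c : ℂ, x = c • f T) ∧
      ∀ T, (n.factorial : ℂ) * (f T).coeff 1 = numSYT n T.shape := by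
  have H' : ∀ p : ShapePair n, ∃ y, y ≠ 0 ∧ IsJoint p.1.1 p.1.2 y := fun p => by
    obtain ⟨x, hx, hx'⟩ := H p.1.2
    exact hx'.exists_of_shape_eq p.2 hx
  choose w hw hwj using H'
  let b : Module.Basis (ShapePair n) ℂ (GA n) :=
    basisOfLinearIndependentOfCardEqFinrank' w (linearIndependent_of_isJoint hw hwj)
      (by rw [card_shapePair, finrank_GA])
  have hb : ∀ p, b p = w p := fun p => by simp [b]
  have hleft : ∀ a p x, b.coord p (jm a * x) = p.1.1.content a * b.coord p x := by
    intro a p x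
    have : b.coord p ∘ₗ LinearMap.mulLeft ℂ (jm a) = (p.1.1.content a : ℂ) • b.coord p := by
      refine b.ext fun q => ?_
      rw [LinearMap.comp_apply, LinearMap.mulLeft_apply, hb, (hwj q a).1, ← hb]
      by_cases hqp : q = p
      · subst hqp; simp
      · simp [Finsupp.single_eq_of_ne (Ne.symm hqp)]
    exact LinearMap.congr_fun this x
  have hright : ∀ a p x, b.coord p (x * jm a) = p.1.2.content a * b.coord p x := by
    intro a p x
    have : b.coord p ∘ₗ LinearMap.mulRight ℂ (jm a) = (p.1.2.content a : ℂ) • b.coord p := by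
      refine b.ext fun q => ?_
      rw [LinearMap.comp_apply, LinearMap.mulRight_apply, hb, (hwj q a).2, ← hb]
      by_cases hqp : q = p
      · subst hqp; simp
      · simp [Finsupp.single_eq_of_ne (Ne.symm hqp)]
    exact LinearMap.congr_fun this x
  have hsupp : ∀ (S T : SYT n) (x : GA n), IsJoint S T x → ∀ p : ShapePair n, p.1 ≠ (S, T) →
      b.coord p x = 0 := by
    intro S T x hx p hp
    by_cases h1 : p.1.1 = S
    · have h2 : p.1.2 ≠ T := fun h2 => hp (Prod.ext h1 h2)
      obtain ⟨a, ha⟩ := exists_content_ne h2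
      have h3 := hright a p x
      rw [(hx a).2, map_smul, smul_eq_mul] at h3
      exact (mul_eq_mul_right_iff.1 h3).resolve_left (Ne.symm ha)
    · obtain ⟨a, ha⟩ := exists_content_ne h1
      have h3 := hleft a p x
      rw [(hx a).1, map_smul, smul_eq_mul] at h3
      exact (mul_eq_mul_right_iff.1 h3).resolve_left (Ne.symm ha)
  refine ⟨fun S T x hST hx => b.ext_elem fun p => ?_, ?_⟩
  · rw [map_zero]
    refine hsupp S T x hx p fun hp => hST ?_
    have := p.2
    rwa [hp] at this
  let f : SYT n → GA n := fun T => b.coord ⟨(T, T), rfl⟩ 1 • w ⟨(T, T), rfl⟩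
  have hfj : ∀ T, IsJoint T T (f T) := fun T => (hwj ⟨(T, T), rfl⟩).smul _
  have hsum : ∑ T, f T = 1 := by
    rw [← b.sum_repr 1]
    -- As `1` commutes with the Jucys–Murphy elements, only the diagonal components occur.
    have hdiag : ∀ p : ShapePair n, p.1.1 ≠ p.1.2 → b.coord p 1 = 0 := by
      intro p hp
      obtain ⟨a, ha⟩ := exists_content_ne hp
      have h3 := hleft a p 1
      rw [mul_one, ← one_mul (jm a), hright] at h3
      exact (mul_eq_mul_right_iff.1 h3).resolve_left (Ne.symm ha)
    refine Finset.sum_of_injOn (fun T => ⟨(T, T), rfl⟩) ?_ ?_ ?_ ?_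
    · intro S _ T _ h
      exact congrArg (fun p : ShapePair n => p.1.1) h
    · simp
    · intro p _ hp
      have : b.repr 1 p = 0 := hdiag p fun h => hp
        ⟨p.1.1, by simp, Subtype.ext (Prod.ext rfl h)⟩
      rw [this, zero_smul]
    · intro T _
      rw [hb]
      rfl
  have hfmul : ∀ T T' x, IsJoint T T' x → f T * x = x := by
    intro T T' x hx
    conv_rhs => rw [← one_mul x, ← hsum, Finset.sum_mul]
    rw [Finset.sum_eq_single T]
    · intro S _ hST
      exact (hfj S).mul_eq_zero hx hST
    · simp
  refine ⟨f, hsum, hfj, fun T => hfmul T T _ (hfj T), fun T x hx => ?_, fun T => ?_⟩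
  · have h1 : x = b.coord ⟨(T, T), rfl⟩ x • w ⟨(T, T), rfl⟩ := by
      conv_lhs => rw [← b.sum_repr x]
      rw [Finset.sum_eq_single ⟨(T, T), rfl⟩]
      · rw [hb]; rfl
      · intro p _ hp
        have : b.repr x p = 0 := hsupp T T x hx p fun h => hp (Subtype.ext h)
        rw [this, zero_smul]
      · simp
    have h2 : b.coord ⟨(T, T), rfl⟩ 1 ≠ 0 := by
      intro h2
      have h3 := hfmul T T _ (hwj ⟨(T, T), rfl⟩)
      simp only [f, h2, zero_smul, zero_mul] at h3
      exact hw _ h3.symm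
    refine ⟨b.coord ⟨(T, T), rfl⟩ x / b.coord ⟨(T, T), rfl⟩ 1, ?_⟩
    rw [smul_smul, div_mul_cancel₀ _ h2]
    exact h1
  · rw [← trace_mulLeft, LinearMap.trace_eq_matrix_trace ℂ b, Matrix.trace, numSYT_eq_numCells,
      ← card_shapePair_fst, Finset.card_filter]
    push_cast
    refine Finset.sum_congr rfl fun p _ => ?_
    rw [Matrix.diag_apply, LinearMap.toMatrix_apply, LinearMap.mulLeft_apply]
    split_ifs with hp
    · subst hp
      rw [hb, hfmul _ _ _ (hwj p), ← hb]
      simp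
    · rw [hb, (hfj T).mul_eq_zero (hwj p) (Ne.symm hp)]
      simp

end Joint

/-! ### Young's semi-normal units -/

section Units

variable {n : ℕ}

theorem numSYT_shape_ne_zero (T : SYT n) : (numSYT n T.shape : ℂ) ≠ 0 := by
  rw [Nat.cast_ne_zero, numSYT_eq_numCells, numCells, Finset.card_ne_zero]
  exact ⟨T, by simp⟩

theorem factorial_cast_ne_zero (n : ℕ) : (n.factorial : ℂ) ≠ 0 :=
  Nat.cast_ne_zero.2 n.factorial_ne_zero

/-- The element `e_{T*} P_T N_T e_{T*}` that Young's recursion normalizes to `e_T`. -/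
def unitCore (T : SYT (n + 1)) : GA (n + 1) :=
  incl n (semiNormalUnit T.star) * T.young * incl n (semiNormalUnit T.star)

theorem semiNormalUnit_succ (T : SYT (n + 1)) : semiNormalUnit T =
    ((numSYT (n + 1) T.shape : ℂ) / ((n + 1).factorial : ℂ)) • unitCore T := by
  rw [semiNormalUnit, unitCore, SYT.young, ← mul_assoc]

theorem isJoint_unitCore (T : SYT (n + 1))
    (h : IsJoint T.star T.star (semiNormalUnit T.star)) : IsJoint T T (unitCore T) := by
  have hleft : ∀ a : Fin n, jm a.castSucc * unitCore T = (T.content a.castSucc : ℂ) • unitCore T :=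
    fun a => by
      rw [← incl_jm, unitCore, ← mul_assoc, ← mul_assoc, ← map_mul, (h a).1, map_smul,
        smul_mul_assoc, smul_mul_assoc, SYT.content_star]
  have hright : ∀ a : Fin n, unitCore T * jm a.castSucc = (T.content a.castSucc : ℂ) • unitCore T :=
    fun a => by
      rw [← incl_jm, unitCore, mul_assoc, ← map_mul, (h a).2, map_smul, mul_smul_comm,
        SYT.content_star]
  -- The last Jucys–Murphy element is the difference of two elements with known action.
  have hcomm : (∑ a, jm a) * unitCore T = (∑ a, (T.content a : ℂ)) • unitCore T := by
    rw [unitCore, ← mul_assoc, ← mul_assoc, (sum_jm_commute (incl n _)).eq, mul_assoc (incl n _),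
      T.sum_jm_mul_young, mul_smul_comm, smul_mul_assoc]
  have hlast : jm (Fin.last n) * unitCore T = (T.content (Fin.last n) : ℂ) • unitCore T := by
    have h1 := hcomm
    rw [Fin.sum_univ_castSucc, Fin.sum_univ_castSucc, add_mul, add_smul, Finset.sum_mul,
      Finset.sum_congr rfl fun a _ => hleft a, ← Finset.sum_smul] at h1
    exact add_left_cancel h1
  have hlast' : unitCore T * jm (Fin.last n) = (T.content (Fin.last n) : ℂ) • unitCore T := by
    have h1 := (sum_jm_commute (unitCore T)).eq.symm.trans hcomm
    rw [Fin.sum_univ_castSucc, Fin.sum_univ_castSucc, mul_add, add_smul, Finset.mul_sum,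
      Finset.sum_congr rfl fun a _ => hright a, ← Finset.sum_smul] at h1
    exact add_left_cancel h1
  intro a
  exact ⟨Fin.lastCases hlast hleft a, Fin.lastCases hlast' hright a⟩

/-- The semi-normal units are idempotent joint eigenvectors of the Jucys–Murphy elements. The last
clause is the normalization that carries the recursion. -/
theorem semiNormalUnit_spec (T : SYT n) : IsJoint T T (semiNormalUnit T) ∧
    semiNormalUnit T * semiNormalUnit T = semiNormalUnit T ∧
    (semiNormalUnit T * T.young).coeff 1 = 1 := by
  induction n with
  | zero =>
    refine ⟨fun a => a.elim0, one_mul _, ?_⟩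
    rw [show semiNormalUnit T = 1 from rfl, one_mul, SYT.coeff_young, Finset.filter_true_of_mem]
    · rw [Fintype.sum_subsingleton _ (1, 1)]
      simp
    · exact fun x _ => ⟨fun a => a.elim0, fun a => a.elim0, Subsingleton.elim _ _⟩
  | succ n ih =>
    have hJ : ∀ T : SYT (n + 1), IsJoint T T (unitCore T) := fun T =>
      isJoint_unitCore T (ih T.star).1
    have hone : ∀ T : SYT (n + 1), (unitCore T).coeff 1 = 1 := fun T => by
      rw [unitCore, coeff_one_mul_comm, ← mul_assoc, ← map_mul, (ih T.star).2.1,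
        SYT.coeff_one_incl_mul_young, (ih T.star).2.2]
    obtain ⟨-, f, -, hf, hff, hfc, hfd⟩ := exists_units_of_isJoint (n := n + 1) fun T =>
      ⟨unitCore T, fun h => by simpa [h] using hone T, hJ T⟩
    obtain ⟨c, hc⟩ := hfc T _ (hJ T)
    have h1 : c * (f T).coeff 1 = 1 := by
      rw [← hone T, hc]
      simp
    have he : semiNormalUnit T = f T := by
      rw [semiNormalUnit_succ, hc, smul_smul, ← hfd T]
      have := factorial_cast_ne_zero (n + 1)
      rw [mul_div_cancel_left₀ _ this, mul_comm, h1, one_smul]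
    rw [he]
    refine ⟨hf T, hff T, ?_⟩
    have h2 : f T * incl n (semiNormalUnit T.star) = f T := by
      rw [← he, semiNormalUnit_succ, smul_mul_assoc, unitCore, mul_assoc (_ * _), ← map_mul,
        (ih T.star).2.1]
    have h3 : incl n (semiNormalUnit T.star) * f T = f T := by
      rw [← he, semiNormalUnit_succ, mul_smul_comm, unitCore, ← mul_assoc, ← mul_assoc, ← map_mul,
        (ih T.star).2.1]
    calc (f T * T.young).coeff 1
        = (incl n (semiNormalUnit T.star) *
            (f T * incl n (semiNormalUnit T.star) * T.young)).coeff 1 := by rw [h2, ← mul_assoc, h3]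
      _ = (f T * unitCore T).coeff 1 := by rw [coeff_one_mul_comm, unitCore]; simp only [mul_assoc]
      _ = 1 := by rw [hc, mul_smul_comm, hff]; simpa using h1

theorem isJoint_semiNormalUnit (T : SYT n) : IsJoint T T (semiNormalUnit T) :=
  (semiNormalUnit_spec T).1

theorem semiNormalUnit_mul_self (T : SYT n) :
    semiNormalUnit T * semiNormalUnit T = semiNormalUnit T :=
  (semiNormalUnit_spec T).2.1

theorem semiNormalUnit_ne_zero (T : SYT n) : semiNormalUnit T ≠ 0 := fun h => by
  simpa [h] using (semiNormalUnit_spec T).2.2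

theorem semiNormalUnit_mul_of_ne {S T : SYT n} (h : S ≠ T) :
    semiNormalUnit S * semiNormalUnit T = 0 :=
  (isJoint_semiNormalUnit S).mul_eq_zero (isJoint_semiNormalUnit T) h

theorem semiNormalUnit_mul_incl_star (T : SYT (n + 1)) :
    semiNormalUnit T * incl n (semiNormalUnit T.star) = semiNormalUnit T := by
  rw [semiNormalUnit_succ, smul_mul_assoc, unitCore, mul_assoc (_ * _), ← map_mul,
    semiNormalUnit_mul_self]

/-- The consequences of the decomposition of the group algebra for the semi-normal units: joint
eigenvectors for different shapes vanish, the units add up to `1`, and the coefficient of the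
identity in `e_T` is `d / n!`. -/
theorem semiNormalUnit_complete :
    (∀ (S T : SYT n) (x : GA n), S.shape ≠ T.shape → IsJoint S T x → x = 0) ∧
      ∑ T : SYT n, semiNormalUnit T = 1 ∧
      ∀ T : SYT n, (n.factorial : ℂ) * (semiNormalUnit T).coeff 1 = numSYT n T.shape := by
  obtain ⟨h0, f, hsum, -, hff, hfc, hfd⟩ := exists_units_of_isJoint (n := n) fun T =>
    ⟨semiNormalUnit T, semiNormalUnit_ne_zero T, isJoint_semiNormalUnit T⟩
  have he : ∀ T : SYT n, semiNormalUnit T = f T := fun T => by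
    obtain ⟨c, hc⟩ := hfc T _ (isJoint_semiNormalUnit T)
    have h1 := semiNormalUnit_mul_self T
    have hne := semiNormalUnit_ne_zero T
    rw [hc] at h1 hne
    rw [smul_mul_smul_comm, hff, ← sub_eq_zero, ← sub_smul] at h1
    have hc0 : c ≠ 0 := fun h => hne (by rw [h, zero_smul])
    have hf0 : f T ≠ 0 := fun h => hne (by rw [h, smul_zero])
    have h2 := (smul_eq_zero.1 h1).resolve_right hf0
    have h3 : c = 1 := mul_left_cancel₀ hc0 (by linear_combination h2)
    rw [hc, h3, one_smul]
  refine ⟨h0, ?_, fun T => ?_⟩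
  · rw [Finset.sum_congr rfl fun T _ => he T, hsum]
  · rw [he, hfd]

theorem sum_semiNormalUnit : ∑ T : SYT n, semiNormalUnit T = 1 := semiNormalUnit_complete.2.1

/-- The sum of the semi-normal units of the tableaux of shape `Y`. -/
def shapeUnit (n : ℕ) (Y : YoungDiagram) : GA n := ∑ T : SYT n with T.shape = Y, semiNormalUnit T

/-- The sum of the semi-normal units of a given shape is central, because units of different shapes
annihilate the group algebra from both sides. -/
theorem shapeUnit_commute (Y : YoungDiagram) (x : GA n) : Commute (shapeUnit n Y) x := by
  have key : ∀ S T : SYT n, S.shape ≠ T.shape → semiNormalUnit S * x * semiNormalUnit T = 0 :=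
    fun S T h => semiNormalUnit_complete.1 S T _ h
      ((isJoint_semiNormalUnit S).mul (isJoint_semiNormalUnit T) x)
  have hcompl : ∑ T : SYT n with ¬ T.shape = Y, semiNormalUnit T = 1 - shapeUnit n Y := by
    rw [eq_sub_iff_add_eq', shapeUnit, Finset.sum_filter_add_sum_filter_not, sum_semiNormalUnit]
  have h1 : shapeUnit n Y * x * (1 - shapeUnit n Y) = 0 := by
    rw [← hcompl, shapeUnit, Finset.sum_mul, Finset.sum_mul_sum]
    refine Finset.sum_eq_zero fun S hS => Finset.sum_eq_zero fun T hT => key S T ?_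
    rw [(Finset.mem_filter.1 hS).2]
    exact Ne.symm (Finset.mem_filter.1 hT).2
  have h2 : (1 - shapeUnit n Y) * x * shapeUnit n Y = 0 := by
    rw [← hcompl, shapeUnit, Finset.sum_mul, Finset.sum_mul_sum]
    refine Finset.sum_eq_zero fun S hS => Finset.sum_eq_zero fun T hT => key S T ?_
    rw [(Finset.mem_filter.1 hT).2]
    exact (Finset.mem_filter.1 hS).2
  rw [Commute, SemiconjBy]
  rw [mul_sub, mul_one, sub_eq_zero] at h1
  rw [sub_mul, one_mul, sub_mul, sub_eq_zero] at h2
  rw [h1, h2]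

/-- A sum of semi-normal units over tableaux `T` with given shapes of `T` and `T*`. -/
theorem shapeUnit_mul_incl (Y Z : YoungDiagram) :
    shapeUnit (n + 1) Y * incl n (shapeUnit n Z) =
      ∑ T : SYT (n + 1) with T.shape = Y ∧ T.star.shape = Z, semiNormalUnit T := by
  rw [← Finset.filter_filter, Finset.sum_filter (p := fun T : SYT (n + 1) => T.star.shape = Z),
    shapeUnit, shapeUnit, Finset.sum_mul]
  refine Finset.sum_congr rfl fun T _ => ?_
  rw [← semiNormalUnit_mul_incl_star T, mul_assoc, ← map_mul, Finset.mul_sum]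
  split_ifs with h
  · rw [Finset.sum_eq_single T.star, semiNormalUnit_mul_self]
    · exact fun S _ hS => semiNormalUnit_mul_of_ne hS.symm
    · exact fun h' => (h' (Finset.mem_filter.2 ⟨Finset.mem_univ T.star, h⟩)).elim
  · rw [Finset.sum_eq_zero, map_zero, mul_zero]
    intro S hS
    exact semiNormalUnit_mul_of_ne fun hne => h (hne ▸ (Finset.mem_filter.1 hS).2)

/-! ### The elements `Γ` -/

theorem hasMarkedShape_iff {T : SYT (n + 1)} {μ : (n + 1).Partition} {j : ℕ} :
    T.HasMarkedShape μ j ↔ T.HasShape μ ∧ T.shape.rowLen (T.pos (Fin.last n)).1 = j ∧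
      (T.pos (Fin.last n)).2 + 1 = j := by
  rw [SYT.HasMarkedShape]
  refine and_congr_right fun _ => ⟨fun h => h (Fin.last n) (by simp), fun h x hx => ?_⟩
  obtain rfl : x = Fin.last n := Fin.ext (by simpa using hx)
  exact h

/-- A Young diagram is determined by the multiset of its row lengths. -/
theorem eq_of_rowLens_eq {Y Z : YoungDiagram} (h : (Y.rowLens : Multiset ℕ) = Z.rowLens) :
    Y = Z := by
  have h1 : Y.rowLens = Z.rowLens :=
    (Multiset.coe_eq_coe.1 h).eq_of_sortedGE Y.rowLens_sorted Z.rowLens_sorted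
  rw [← YoungDiagram.ofRowLens_to_rowLens_eq_self (μ := Y),
    ← YoungDiagram.ofRowLens_to_rowLens_eq_self (μ := Z)]
  congr 1

/-- Within one column of a shape there is only one place for the largest label. -/
theorem pos_last_eq {T : SYT (n + 1)} {b : ℕ × ℕ} (hb : b ∈ T.shape)
    (hmax : ∀ c ∈ T.shape, b ≤ c → c = b) (h : (T.pos (Fin.last n)).2 = b.2) :
    T.pos (Fin.last n) = b := by
  rcases le_total (T.pos (Fin.last n)).1 b.1 with h1 | h1
  · exact (T.eq_last_of_le hb ⟨h1, h.le⟩).symm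
  · exact hmax _ (T.mem_shape.2 ⟨_, rfl⟩) ⟨h1, h.ge⟩

/-- If the box `b` can be added to `Z`, giving the shape `μ`, then the tableaux in `SYT_{μ,j}`,
where `j` is the length of the row of `b`, are those which arise from the shape `Z` by adding
`b`. -/
theorem hasMarkedShape_iff_star {Z Y : YoungDiagram} {b : ℕ × ℕ} (hb : b ∉ Z)
    (hY : Y.cells = insert b Z.cells) {μ : (n + 1).Partition}
    (hμ : (Y.rowLens : Multiset ℕ) = μ.parts) (T : SYT (n + 1)) :
    T.HasMarkedShape μ (b.2 + 1) ↔ T.star.shape = Z ∧ T.pos (Fin.last n) = b := by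
  rw [hasMarkedShape_iff, SYT.HasShape, ← hμ]
  constructor
  · rintro ⟨h1, -, h3⟩
    have hTY := eq_of_rowLens_eq h1
    have hbY : b ∈ Y := by
      rw [← YoungDiagram.mem_cells, hY]
      exact Finset.mem_insert_self _ _
    have hmax : ∀ c ∈ Y, b ≤ c → c = b := by
      intro c hc hbc
      rw [← YoungDiagram.mem_cells, hY, Finset.mem_insert] at hc
      exact hc.resolve_right fun hc => hb (Z.isLowerSet hbc hc)
    have hl := pos_last_eq (hTY ▸ hbY) (hTY ▸ hmax) (by omega)
    refine ⟨YoungDiagram.ext ?_, hl⟩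
    have h4 := T.cells_shape_star
    have h5 : b ∉ T.star.shape.cells := hl ▸ T.last_notMem_star
    rw [hTY, hY, hl] at h4
    rw [← Finset.erase_insert h5, ← h4, Finset.erase_insert hb]
  · rintro ⟨rfl, rfl⟩
    have hTY : T.shape = Y := YoungDiagram.ext (by rw [T.cells_shape_star, hY])
    refine ⟨by rw [hTY], le_antisymm ?_ ?_, rfl⟩
    · by_contra! h
      have h1 := T.eq_last_of_le (YoungDiagram.mem_iff_lt_rowLen.2 h) ⟨le_rfl, Nat.le_succ _⟩
      have := congrArg Prod.snd h1
      simp at this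
    · exact Nat.succ_le_of_lt (YoungDiagram.mem_iff_lt_rowLen.1 (T.mem_shape.2 ⟨_, rfl⟩))

/-- `SYT_{μ,j}` is described through any one of its elements. -/
theorem hasMarkedShape_iff_of_mem {μ : (n + 1).Partition} {j : ℕ} {T₀ : SYT (n + 1)}
    (h₀ : T₀.HasMarkedShape μ j) (T : SYT (n + 1)) :
    T.HasMarkedShape μ j ↔ T.shape = T₀.shape ∧ T.star.shape = T₀.star.shape := by
  obtain ⟨h1, -, rfl⟩ := hasMarkedShape_iff.1 h₀
  rw [hasMarkedShape_iff_star T₀.last_notMem_star T₀.cells_shape_star h1, and_comm]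
  refine and_congr_left fun h => ⟨fun h' => ?_, fun h' => ?_⟩
  · exact YoungDiagram.ext (by rw [T.cells_shape_star, T₀.cells_shape_star, h, h'])
  · have h2 := T.cells_shape_star
    rw [h', h, T₀.cells_shape_star] at h2
    have h3 : T.pos (Fin.last n) ∈ insert (T₀.pos (Fin.last n)) T₀.star.shape.cells := by
      rw [h2]
      exact Finset.mem_insert_self _ _
    refine (Finset.mem_insert.1 h3).resolve_right fun h4 => T.last_notMem_star ?_
    rw [h]
    exact h4

/-- `Γ^{μ,j}` commutes with the subgroup that fixes the last symbol. -/
theorem bigGamma_commute (μ : (n + 1).Partition) (j : ℕ) (x : GA n) :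
    Commute (bigGamma μ j) (incl n x) := by
  by_cases h : ∃ T₀ : SYT (n + 1), T₀.HasMarkedShape μ j
  · obtain ⟨T₀, h₀⟩ := h
    have : bigGamma μ j =
        shapeUnit (n + 1) T₀.shape * incl n (shapeUnit n T₀.star.shape) := by
      rw [shapeUnit_mul_incl, bigGamma]
      refine Finset.sum_congr ?_ fun _ _ => rfl
      ext T
      simp only [Finset.mem_filter, Finset.mem_univ, true_and, hasMarkedShape_iff_of_mem h₀]
    rw [this]
    refine (shapeUnit_commute _ _).mul_left ?_
    rw [Commute, SemiconjBy, ← map_mul, ← map_mul, (shapeUnit_commute _ x).eq]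
  · push Not at h
    rw [bigGamma, Finset.sum_eq_zero]
    · exact Commute.zero_left _
    · exact fun T hT => absurd (Finset.mem_filter.1 hT).2 (h T)

end Units

/-! ### Conjugacy under the permutations that fix a symbol -/

section Conjugacy

theorem zpow_apply_eq_self_iff {α : Type*} (q : Equiv.Perm α) (x : α) (k : ℤ) :
    (q ^ k) x = x ↔ (Function.minimalPeriod q x : ℤ) ∣ k :=
  MulAction.zpow_smul_eq_iff_minimalPeriod_dvd (a := q) (b := x)

theorem zpow_apply_eq_iff {α : Type*} (q : Equiv.Perm α) (x : α) (k l : ℤ) :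
    (q ^ k) x = (q ^ l) x ↔ (Function.minimalPeriod q x : ℤ) ∣ k - l := by
  rw [← zpow_apply_eq_self_iff, sub_eq_neg_add, zpow_add, Equiv.Perm.mul_apply, zpow_neg,
    Equiv.Perm.inv_eq_iff_eq]

/-- Two points on cycles of the same length are exchanged by a permutation that commutes with the
given one: a power of it, if they are on the same cycle, and otherwise the involution that
exchanges the two cycles. -/
theorem exists_commute_apply_eq {α : Type*} (q : Equiv.Perm α) {p x : α}
    (h : Function.minimalPeriod q p = Function.minimalPeriod q x) :
    ∃ ζ : Equiv.Perm α, Commute ζ q ∧ ζ p = x := by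
  by_cases hpx : ∃ k : ℤ, (q ^ k) p = x
  · obtain ⟨k, hk⟩ := hpx
    exact ⟨q ^ k, (Commute.refl q).zpow_left k, hk⟩
  push Not at hpx
  have hdisj : ∀ k l : ℤ, (q ^ k) p ≠ (q ^ l) x := fun k l hkl => hpx (k - l) (by
    rw [sub_eq_neg_add, zpow_add, Equiv.Perm.mul_apply, hkl, zpow_neg, Equiv.Perm.inv_eq_iff_eq])
  have hpx' : ∀ k l : ℤ, (q ^ k) p = (q ^ l) p ↔ (q ^ k) x = (q ^ l) x := fun k l => by
    rw [zpow_apply_eq_iff, zpow_apply_eq_iff, h]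
  let f : α → α := fun y => if h1 : ∃ k : ℤ, (q ^ k) p = y then (q ^ h1.choose) x else
    if h2 : ∃ k : ℤ, (q ^ k) x = y then (q ^ h2.choose) p else y
  have fp : ∀ k : ℤ, f ((q ^ k) p) = (q ^ k) x := by
    intro k
    have h1 : ∃ l : ℤ, (q ^ l) p = (q ^ k) p := ⟨k, rfl⟩
    simp only [f, dif_pos h1]
    exact (hpx' _ _).1 h1.choose_spec
  have fx : ∀ k : ℤ, f ((q ^ k) x) = (q ^ k) p := by
    intro k
    have h1 : ¬ ∃ l : ℤ, (q ^ l) p = (q ^ k) x := fun ⟨l, hl⟩ => hdisj l k hl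
    have h2 : ∃ l : ℤ, (q ^ l) x = (q ^ k) x := ⟨k, rfl⟩
    simp only [f, dif_neg h1, dif_pos h2]
    exact (hpx' _ _).2 h2.choose_spec
  have fo : ∀ y, (¬ ∃ k : ℤ, (q ^ k) p = y) → (¬ ∃ k : ℤ, (q ^ k) x = y) → f y = y :=
    fun y h1 h2 => by simp only [f, dif_neg h1, dif_neg h2]
  have hinv : Function.Involutive f := by
    intro y
    by_cases h1 : ∃ k : ℤ, (q ^ k) p = y
    · obtain ⟨k, rfl⟩ := h1
      rw [fp, fx]
    by_cases h2 : ∃ k : ℤ, (q ^ k) x = y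
    · obtain ⟨k, rfl⟩ := h2
      rw [fx, fp]
    rw [fo y h1 h2, fo y h1 h2]
  have hstep : ∀ z y : α, (∃ k : ℤ, (q ^ k) z = q y) → ∃ k : ℤ, (q ^ k) z = y := by
    rintro z y ⟨k, hk⟩
    refine ⟨-1 + k, ?_⟩
    rw [zpow_add, Equiv.Perm.mul_apply, hk, zpow_neg_one]
    exact q.symm_apply_apply y
  have hsucc : ∀ (z : α) (k : ℤ), q ((q ^ k) z) = (q ^ (1 + k)) z := fun z k => by
    rw [zpow_add, zpow_one, Equiv.Perm.mul_apply]
  refine ⟨hinv.toPerm f, Equiv.ext fun y => ?_, fp 0⟩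
  change f (q y) = q (f y)
  by_cases h1 : ∃ k : ℤ, (q ^ k) p = y
  · obtain ⟨k, rfl⟩ := h1
    rw [hsucc, fp, fp, hsucc]
  by_cases h2 : ∃ k : ℤ, (q ^ k) x = y
  · obtain ⟨k, rfl⟩ := h2
    rw [hsucc, fx, fx, hsucc]
  rw [fo y h1 h2, fo _ (fun h => h1 (hstep p y h)) (fun h => h2 (hstep x y h))]

theorem minimalPeriod_conj {α : Type*} (c q : Equiv.Perm α) (x : α) :
    Function.minimalPeriod (c * q * c⁻¹ : Equiv.Perm α) (c x) = Function.minimalPeriod q x := by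
  have h : ∀ k : ℤ, ((c * q * c⁻¹) ^ k) (c x) = c x ↔ (q ^ k) x = x := fun k => by
    rw [conj_zpow, Equiv.Perm.mul_apply, Equiv.Perm.mul_apply,
      show c⁻¹ (c x) = x from c.symm_apply_apply x, c.injective.eq_iff]
  simp only [zpow_apply_eq_self_iff] at h
  exact Nat.dvd_antisymm (Int.natCast_dvd_natCast.1 ((h _).2 dvd_rfl))
    (Int.natCast_dvd_natCast.1 ((h _).1 dvd_rfl))

variable {n : ℕ}

/-- Permutations of the same cycle type, in which the last symbol lies on cycles of the same
length, are conjugate by a permutation that fixes the last symbol. -/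
theorem exists_up_conj {π τ : Equiv.Perm (Fin (n + 1))}
    (h : π.partition.parts = τ.partition.parts)
    (hl : Function.minimalPeriod π (Fin.last n) = Function.minimalPeriod τ (Fin.last n)) :
    ∃ σ : Equiv.Perm (Fin n), up σ * π * (up σ)⁻¹ = τ := by
  obtain ⟨c, hc⟩ := isConj_iff.1 (Equiv.Perm.partition_eq_of_isConj.2 (Nat.Partition.ext h))
  obtain ⟨ζ, hζ, hζc⟩ := exists_commute_apply_eq τ (p := c (Fin.last n)) (x := Fin.last n)
    (by rw [← hl, ← hc, minimalPeriod_conj])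
  obtain ⟨σ, hσ⟩ := exists_up_eq (τ := ζ * c) hζc
  refine ⟨σ, ?_⟩
  rw [hσ, mul_inv_rev, ← mul_inv_eq_iff_eq_mul.2 hζ.eq, ← hc]
  simp only [mul_assoc]

theorem minimalPeriod_mem_parts (π : Equiv.Perm (Fin n)) (x : Fin n) :
    Function.minimalPeriod π x ∈ π.partition.parts := by
  rw [Equiv.Perm.parts_partition, Multiset.mem_add]
  by_cases hx : π x = x
  · right
    rw [Function.minimalPeriod_eq_one_iff_isFixedPt.2 hx, Multiset.mem_replicate]
    refine ⟨(Nat.sub_pos_of_lt ?_).ne', rfl⟩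
    exact Finset.card_lt_univ_of_notMem (x := x) (by simpa using hx)
  · left
    have hcyc := Equiv.Perm.isCycleOn_support_cycleOf π x
    have hmem : x ∈ (π.cycleOf x).support := by
      rw [Equiv.Perm.mem_support_cycleOf_iff]
      exact ⟨Equiv.Perm.SameCycle.refl _ _, by simpa using hx⟩
    have h : ∀ k : ℤ, (π ^ k) x = x ↔ ((π.cycleOf x).support.card : ℤ) ∣ k := fun k =>
      hcyc.zpow_apply_eq hmem
    simp only [zpow_apply_eq_self_iff] at h
    rw [Nat.dvd_antisymm (Int.natCast_dvd_natCast.1 ((h _).2 dvd_rfl))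
      (Int.natCast_dvd_natCast.1 ((h _).1 dvd_rfl)), Equiv.Perm.cycleType_def]
    refine Multiset.mem_map.2 ⟨π.cycleOf x, ?_, rfl⟩
    exact Equiv.Perm.cycleOf_mem_cycleFactorsFinset_iff.2 (by simpa using hx)

/-! ### Expansion in marked class sums -/

theorem mem_markedClass {ν : (n + 1).Partition} {i : ℕ} {π : Equiv.Perm (Fin (n + 1))} :
    π ∈ markedClass ν i ↔
      π.partition.parts = ν.parts ∧ Function.minimalPeriod π (Fin.last n) = i := by
  rw [markedClass, Finset.mem_filter, and_iff_right (Finset.mem_univ _)]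
  refine and_congr_right fun _ => ⟨fun h => h (Fin.last n) (by simp), fun h x hx => ?_⟩
  obtain rfl : x = Fin.last n := Fin.ext (by simpa using hx)
  exact h

theorem coeff_classSum (ν : n.Partition) (i : ℕ) (π : Equiv.Perm (Fin n)) :
    (classSum ν i).coeff π = if π ∈ markedClass ν i then 1 else 0 := by
  rw [classSum, MonoidAlgebra.coeff_sum, Finsupp.finsetSum_apply]
  simp [Finsupp.single_apply]

theorem coeff_sum_classSum (a : (n + 1).Partition → ℕ → ℂ) {ν : (n + 1).Partition} {i : ℕ}
    {π : Equiv.Perm (Fin (n + 1))} (hπ : π ∈ markedClass ν i) :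
    (∑ ν : (n + 1).Partition, ∑ i ∈ ν.parts.toFinset, a ν i • classSum ν i).coeff π = a ν i := by
  obtain ⟨h1, h2⟩ := mem_markedClass.1 hπ
  simp only [MonoidAlgebra.coeff_sum, Finsupp.finsetSum_apply, MonoidAlgebra.coeff_smul,
    Finsupp.smul_apply, coeff_classSum]
  rw [Finset.sum_eq_single ν, Finset.sum_eq_single i, if_pos hπ, smul_eq_mul, mul_one]
  · intro k _ hk
    rw [if_neg, smul_zero]
    exact fun h => hk ((mem_markedClass.1 h).2.symm.trans h2)
  · intro hi
    refine absurd ?_ hi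
    rw [Multiset.mem_toFinset, ← h1, ← h2]
    exact minimalPeriod_mem_parts π _
  · intro ρ _ hρ
    refine Finset.sum_eq_zero fun k _ => ?_
    rw [if_neg, smul_zero]
    exact fun h => hρ (Nat.Partition.ext ((mem_markedClass.1 h).1.symm.trans h1))
  · simp

theorem exists_mem_markedClass (π : Equiv.Perm (Fin (n + 1))) :
    ∃ (ν : (n + 1).Partition) (i : ℕ), π ∈ markedClass ν i :=
  ⟨⟨π.partition.parts, π.partition.parts_pos, by simpa using π.partition.parts_sum⟩, _,
    mem_markedClass.2 ⟨rfl, rfl⟩⟩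

/-- An element that commutes with the permutations fixing the last symbol has constant
coefficients on marked classes. -/
theorem coeff_eq_of_mem_markedClass {x : GA (n + 1)} (hx : ∀ y : GA n, Commute x (incl n y))
    {ν : (n + 1).Partition} {i : ℕ} {π τ : Equiv.Perm (Fin (n + 1))} (hπ : π ∈ markedClass ν i)
    (hτ : τ ∈ markedClass ν i) : x.coeff π = x.coeff τ := by
  obtain ⟨h1, h2⟩ := mem_markedClass.1 hπ
  obtain ⟨h3, h4⟩ := mem_markedClass.1 hτ
  obtain ⟨σ, rfl⟩ := exists_up_conj (h1.trans h3.symm) (h2.trans h4.symm)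
  have h := congrArg (fun z => z.coeff (up σ * π)) (hx (grp σ)).eq
  simp only [incl_grp, MonoidAlgebra.coeff_mul_single_apply, MonoidAlgebra.coeff_single_mul_apply,
    one_mul, mul_one, inv_mul_cancel_left] at h
  exact h.symm

theorem exists_isExpansion {x : GA (n + 1)} (hx : ∀ y : GA n, Commute x (incl n y)) :
    ∃ a, IsExpansion x a := by
  refine ⟨fun ν i => if h : (markedClass ν i).Nonempty then x.coeff h.choose else 0, ?_⟩
  refine MonoidAlgebra.coeff_injective (Finsupp.ext fun π => ?_)
  obtain ⟨ν, i, hπ⟩ := exists_mem_markedClass π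
  have h : (markedClass ν i).Nonempty := ⟨π, hπ⟩
  rw [coeff_sum_classSum _ hπ, dif_pos h]
  exact coeff_eq_of_mem_markedClass hx hπ h.choose_spec

theorem coeffK_eq {x : GA (n + 1)} (hx : ∀ y : GA n, Commute x (incl n y))
    {ν : (n + 1).Partition} {i : ℕ} {π : Equiv.Perm (Fin (n + 1))} (hπ : π ∈ markedClass ν i) :
    coeffK ν i x = x.coeff π := by
  have h := exists_isExpansion hx
  rw [coeffK, dif_pos h]
  conv_rhs => rw [h.choose_spec]
  exact (coeff_sum_classSum _ hπ).symm

end Conjugacy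

/-! ### Long cycles as a product of Jucys–Murphy elements -/

section LongCycles

/-- The product of the Jucys–Murphy elements of all labels but the first. -/
def jmProd : (k : ℕ) → GA (k + 1)
  | 0 => 1
  | k + 1 => incl (k + 1) (jmProd k) * jm (Fin.last (k + 1))

theorem sameCycle_up_mul_swap {k : ℕ} {σ : Equiv.Perm (Fin (k + 1))}
    (h : ∀ x y, σ.SameCycle x y) (b : Fin (k + 1)) (x y : Fin (k + 2)) :
    (up σ * Equiv.swap b.castSucc (Fin.last (k + 1))).SameCycle x y := by
  set τ := up σ * Equiv.swap b.castSucc (Fin.last (k + 1)) with hτ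
  have h1 : τ b.castSucc = Fin.last (k + 1) := by
    rw [hτ, Equiv.Perm.mul_apply, Equiv.swap_apply_left, up_last]
  have h2 : τ (Fin.last (k + 1)) = (σ b).castSucc := by
    rw [hτ, Equiv.Perm.mul_apply, Equiv.swap_apply_right, up_castSucc]
  have hstep : ∀ a, τ.SameCycle a.castSucc (σ a).castSucc := by
    intro a
    by_cases hab : a = b
    · subst hab
      rw [← h2, ← h1]
      exact ⟨2, rfl⟩
    · have h3 : τ a.castSucc = (σ a).castSucc := by
        rw [hτ, Equiv.Perm.mul_apply, Equiv.swap_apply_of_ne_of_ne, up_castSucc]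
        · exact fun h => hab (Fin.castSucc_injective _ h)
        · exact (Fin.castSucc_lt_last a).ne
      rw [← h3]
      exact ⟨1, rfl⟩
  have hpow : ∀ (i : ℕ) a, τ.SameCycle a.castSucc ((σ ^ i) a).castSucc := by
    intro i a
    induction i with
    | zero => exact Equiv.Perm.SameCycle.refl _ _
    | succ i ih =>
      rw [pow_succ', Equiv.Perm.mul_apply]
      exact ih.trans (hstep _)
  have hcast : ∀ a c : Fin (k + 1), τ.SameCycle a.castSucc c.castSucc := by
    intro a c
    obtain ⟨i, -, rfl⟩ := (h a c).exists_pow_eq'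
    exact hpow i a
  have hb : ∀ x, τ.SameCycle b.castSucc x :=
    Fin.lastCases ⟨1, h1⟩ fun a => hcast b a
  exact (hb x).symm.trans (hb y)

/-- The product `jmProd k` consists of `k!` permutations with only one cycle. Therefore a linear
functional that is constant on such permutations is easy to evaluate on it. -/
theorem map_jmProd (k : ℕ) (φ : GA (k + 1) →ₗ[ℂ] ℂ) (c : ℂ)
    (h : ∀ σ : Equiv.Perm (Fin (k + 1)), (∀ x y, σ.SameCycle x y) → φ (grp σ) = c) :
    φ (jmProd k) = k.factorial * c := by
  induction k generalizing c with
  | zero =>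
    rw [Nat.factorial_zero, Nat.cast_one, one_mul]
    refine h 1 fun x y => ?_
    rw [show x = y from Fin.ext (by omega)]
  | succ k ih =>
    have h1 := ih (φ ∘ₗ LinearMap.mulRight ℂ (jm (Fin.last (k + 1))) ∘ₗ (incl (k + 1)).toLinearMap)
      ((k + 1 : ℕ) * c) (by
        intro σ hσ
        simp only [LinearMap.comp_apply, AlgHom.toLinearMap_apply, LinearMap.mulRight_apply,
          incl_grp]
        rw [jm, Finset.sum_filter, Fin.sum_univ_castSucc, if_neg (lt_irrefl _), add_zero,
          Finset.mul_sum, map_sum]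
        simp only [if_pos (Fin.castSucc_lt_last _), grp_mul]
        rw [Finset.sum_congr rfl fun b _ => h _ (sameCycle_up_mul_swap hσ b)]
        simp)
    simp only [LinearMap.comp_apply, AlgHom.toLinearMap_apply, LinearMap.mulRight_apply] at h1
    rw [jmProd, h1, Nat.factorial_succ]
    push_cast
    ring

theorem semiNormalUnit_mul_jmProd (k : ℕ) (T : SYT (k + 1)) :
    semiNormalUnit T * jmProd k = (∏ a : Fin k, (T.content a.succ : ℂ)) • semiNormalUnit T := by
  induction k with
  | zero => simp [jmProd]
  | succ k ih =>
    rw [jmProd, ← mul_assoc, ← semiNormalUnit_mul_incl_star T, mul_assoc (semiNormalUnit T),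
      ← map_mul, ih T.star, map_smul, mul_smul_comm, semiNormalUnit_mul_incl_star, smul_mul_assoc,
      (isJoint_semiNormalUnit T _).2, smul_smul, Fin.prod_univ_castSucc]
    rfl

/-- A permutation with only one cycle, extended by a fixed symbol. -/
theorem up_mem_markedClass {k : ℕ} {ν : (k + 2).Partition} (hν : ν.parts = {k + 1, 1})
    {σ : Equiv.Perm (Fin (k + 1))} (h : ∀ x y, σ.SameCycle x y) : up σ ∈ markedClass ν 1 := by
  rw [mem_markedClass]
  refine ⟨?_, Function.minimalPeriod_eq_one_iff_isFixedPt.2 (up_last σ)⟩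
  rw [hν, Equiv.Perm.parts_partition, ← Equiv.Perm.sum_cycleType, cycleType_up, Fintype.card_fin]
  cases k with
  | zero =>
    have : σ = 1 := Equiv.ext fun x => Fin.ext (by omega)
    subst this
    rw [Equiv.Perm.cycleType_one]
    rfl
  | succ k =>
    have hne : ∀ x, σ x ≠ x := by
      intro x hx
      obtain ⟨y, hy⟩ := exists_ne x
      exact hy ((h x y).eq_of_left hx).symm
    have hc : σ.IsCycle := ⟨0, hne 0, fun y _ => h 0 y⟩
    have hs : σ.support = Finset.univ := by
      ext x
      simp [hne x]
    rw [hc.cycleType, hs, Finset.card_univ, Fintype.card_fin, Multiset.sum_singleton,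
      show k + 1 + 2 - (k + 1 + 1) = 1 by omega]
    rfl

/-- The generalized character at a long cycle that misses the last symbol, in terms of the contents
of tableaux. -/
theorem factorial_mul_genChar {k : ℕ} {ν : (k + 2).Partition} (hν : ν.parts = {k + 1, 1})
    (μ : (k + 2).Partition) (j : ℕ) :
    (k.factorial : ℂ) * genChar μ j ν 1 =
      ∑ T : SYT (k + 2) with T.HasMarkedShape μ j, ∏ a : Fin k, (T.star.content a.succ : ℂ) := by
  have hcomm := fun x => bigGamma_commute (n := k + 1) μ j x
  have h1 : (bigGamma μ j * incl (k + 1) (jmProd k)).coeff 1 =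
      k.factorial * coeffK ν 1 (bigGamma μ j) := by
    let φ : GA (k + 1) →ₗ[ℂ] ℂ := Finsupp.lapply 1 ∘ₗ
      (MonoidAlgebra.coeffLinearEquiv ℂ).toLinearMap ∘ₗ
      LinearMap.mulLeft ℂ (bigGamma μ j) ∘ₗ (incl (k + 1)).toLinearMap
    have hφ : ∀ x, φ x = (bigGamma μ j * incl (k + 1) x).coeff 1 := fun x => rfl
    rw [← hφ]
    refine map_jmProd k φ _ fun σ hσ => ?_
    rw [hφ, incl_grp, MonoidAlgebra.coeff_mul_single_apply, mul_one, one_mul, ← map_inv]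
    refine (coeffK_eq hcomm (up_mem_markedClass hν fun x y => ?_)).symm
    exact (hσ x y).inv
  have h2 : ∀ T : SYT (k + 2), T.HasMarkedShape μ j →
      ((k + 2).factorial : ℂ) / (degree μ : ℂ) *
        (semiNormalUnit T * incl (k + 1) (jmProd k)).coeff 1 =
      ∏ a : Fin k, (T.star.content a.succ : ℂ) := by
    intro T hT
    have hd : degree μ = numSYT (k + 2) T.shape := by
      rw [degree, numSYT]
      congr 2
      ext S
      rw [SYT.HasShape, ← hT.1]
      exact ⟨eq_of_rowLens_eq, fun h => by rw [h]⟩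
    have h3 := semiNormalUnit_complete.2.2 T
    have h4 := numSYT_shape_ne_zero T
    rw [← semiNormalUnit_mul_incl_star T, mul_assoc, ← map_mul, semiNormalUnit_mul_jmProd,
      map_smul, mul_smul_comm, semiNormalUnit_mul_incl_star, MonoidAlgebra.coeff_smul,
      Finsupp.smul_apply, smul_eq_mul, hd]
    rw [div_mul_eq_mul_div, div_eq_iff h4, ← h3]
    ring
  rw [genChar, mul_left_comm, ← h1]
  rw [bigGamma, Finset.sum_mul, MonoidAlgebra.coeff_sum, Finsupp.finsetSum_apply, Finset.mul_sum]
  exact Finset.sum_congr rfl fun T hT => h2 T (Finset.mem_filter.1 hT).2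

end LongCycles

/-! ### Hooks -/

/-- The hook with arm length `a` and leg length `l`. -/
def hook (a l : ℕ) : YoungDiagram where
  cells := ((Finset.range (a + 1)).image fun c => (0, c)) ∪
    ((Finset.range l).image fun r => (r + 1, 0))
  isLowerSet := by
    rintro ⟨r, c⟩ ⟨r', c'⟩ ⟨h1, h2⟩ h
    simp only [Finset.coe_union, Finset.coe_image, Set.mem_union, Set.mem_image, Finset.mem_coe,
      Finset.mem_range, Prod.mk.injEq] at h h1 h2 ⊢
    rcases h with ⟨x, hx, rfl, rfl⟩ | ⟨x, hx, rfl, rfl⟩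
    · exact .inl ⟨c', by omega, by omega, rfl⟩
    · cases r' with
      | zero => exact .inl ⟨c', by omega, rfl, rfl⟩
      | succ r' => exact .inr ⟨r', by omega, rfl, by omega⟩

theorem mem_hook {a l r c : ℕ} : (r, c) ∈ hook a l ↔ r = 0 ∧ c ≤ a ∨ c = 0 ∧ r ≤ l := by
  rw [← YoungDiagram.mem_cells]
  simp only [hook, Finset.mem_union, Finset.mem_image, Finset.mem_range, Prod.mk.injEq]
  constructor
  · rintro (⟨x, hx, rfl, rfl⟩ | ⟨x, hx, rfl, rfl⟩) <;> omega
  · rintro (⟨rfl, h⟩ | ⟨rfl, h⟩)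
    · exact .inl ⟨c, by omega, rfl, rfl⟩
    · cases r with
      | zero => exact .inl ⟨0, by omega, rfl, rfl⟩
      | succ r => exact .inr ⟨r, by omega, rfl, rfl⟩

theorem prod_hook {M : Type*} [CommMonoid M] (a l : ℕ) (g : ℕ × ℕ → M) :
    ∏ b ∈ (hook a l).cells, g b =
      (∏ c ∈ Finset.range (a + 1), g (0, c)) * ∏ r ∈ Finset.range l, g (r + 1, 0) := by
  rw [hook, Finset.prod_union, Finset.prod_image (by simp), Finset.prod_image (by simp)]
  rw [Finset.disjoint_left]
  rintro x h1 h2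
  obtain ⟨c, -, rfl⟩ := Finset.mem_image.1 h1
  obtain ⟨r, -, h⟩ := Finset.mem_image.1 h2
  simp at h

theorem card_hook (a l : ℕ) : (hook a l).cells.card = a + l + 1 := by
  rw [hook, Finset.card_union_of_disjoint, Finset.card_image_of_injective _ (fun x y h => by
    simpa using h), Finset.card_image_of_injective _ (fun x y h => by simpa using h)]
  · simp only [Finset.card_range]
    omega
  · rw [Finset.disjoint_left]
    rintro x h1 h2
    obtain ⟨c, -, rfl⟩ := Finset.mem_image.1 h1
    obtain ⟨r, -, h⟩ := Finset.mem_image.1 h2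
    simp at h

theorem insert_hook_arm (a l : ℕ) :
    (hook (a + 1) l).cells = insert (0, a + 1) (hook a l).cells := by
  ext ⟨r, c⟩
  simp only [Finset.mem_insert, YoungDiagram.mem_cells, mem_hook, Prod.mk.injEq]
  omega

theorem insert_hook_leg (a l : ℕ) :
    (hook a (l + 1)).cells = insert (l + 1, 0) (hook a l).cells := by
  ext ⟨r, c⟩
  simp only [Finset.mem_insert, YoungDiagram.mem_cells, mem_hook, Prod.mk.injEq]
  omega

/-- Only the two ends of a hook can be removed. -/
theorem numCells_erase_hook {n a l : ℕ} {b : ℕ × ℕ} (hb : b ∈ (hook a l).cells)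
    (h1 : b ≠ (0, a) ∨ 0 < l ∧ a = 0) (h2 : b ≠ (l, 0) ∨ 0 < a ∧ l = 0) :
    numCells n ((hook a l).cells.erase b) = 0 := by
  refine numCells_eq_zero fun hlow => ?_
  obtain ⟨r, c⟩ := b
  have key : ∀ d ∈ (hook a l).cells, (r, c) ≤ d → d = (r, c) := by
    intro d hd hle
    by_contra hne
    have := hlow hle (Finset.mem_coe.2 (Finset.mem_erase.2 ⟨hne, hd⟩))
    simp at this
  rw [YoungDiagram.mem_cells, mem_hook] at hb
  have k1 := key (0, a) (by rw [YoungDiagram.mem_cells, mem_hook]; omega)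
  have k2 := key (l, 0) (by rw [YoungDiagram.mem_cells, mem_hook]; omega)
  simp only [Prod.mk_le_mk, Prod.mk.injEq, ne_eq] at k1 k2 h1 h2
  omega

theorem numCells_hook_zero_zero : numCells 1 (hook 0 0).cells = 1 := by
  have h : (hook 0 0).cells = {(0, 0)} := by
    ext ⟨r, c⟩
    simp only [Finset.mem_singleton, YoungDiagram.mem_cells, mem_hook, Prod.mk.injEq]
    omega
  have h0 := sum_numCells_shape 0
  rw [numCells_succ, h, Finset.sum_singleton, Finset.erase_singleton]
  rw [numCells, Finset.filter_true_of_mem, Finset.card_univ]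
  · have h2 : ∀ T : SYT 0, numCells 0 T.shape.cells = Fintype.card (SYT 0) := fun T => by
      rw [numCells, Finset.filter_true_of_mem, Finset.card_univ]
      intro S _
      rw [show S = T from SYT.ext (funext fun i => i.elim0)]
    rw [Finset.sum_congr rfl fun T _ => h2 T] at h0
    simpa using h0
  · intro T _
    rw [← Finset.card_eq_zero, T.card_cells_shape]

theorem numCells_hook_succ_zero (a : ℕ) :
    numCells (a + 2) (hook (a + 1) 0).cells = numCells (a + 1) (hook a 0).cells := by
  have hmem : (0, a + 1) ∈ (hook (a + 1) 0).cells := by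
    rw [YoungDiagram.mem_cells, mem_hook]; omega
  have hnot : (0, a + 1) ∉ (hook a 0).cells := by
    rw [YoungDiagram.mem_cells, mem_hook]; omega
  rw [numCells_succ, Finset.sum_eq_single_of_mem _ hmem, insert_hook_arm, Finset.erase_insert hnot]
  exact fun b hb hne => numCells_erase_hook hb (.inl hne) (.inr ⟨by omega, rfl⟩)

theorem numCells_hook_zero_succ (l : ℕ) :
    numCells (l + 2) (hook 0 (l + 1)).cells = numCells (l + 1) (hook 0 l).cells := by
  have hmem : (l + 1, 0) ∈ (hook 0 (l + 1)).cells := by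
    rw [YoungDiagram.mem_cells, mem_hook]; omega
  have hnot : (l + 1, 0) ∉ (hook 0 l).cells := by
    rw [YoungDiagram.mem_cells, mem_hook]; omega
  rw [numCells_succ, Finset.sum_eq_single_of_mem _ hmem, insert_hook_leg, Finset.erase_insert hnot]
  exact fun b hb hne => numCells_erase_hook hb (.inr ⟨by omega, rfl⟩) (.inl hne)

theorem numCells_hook_succ_succ (n a l : ℕ) :
    numCells (n + 1) (hook (a + 1) (l + 1)).cells =
      numCells n (hook a (l + 1)).cells + numCells n (hook (a + 1) l).cells := by
  have hne : ((0, a + 1) : ℕ × ℕ) ≠ (l + 1, 0) := by simp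
  have hn1 : (0, a + 1) ∉ (hook a (l + 1)).cells := by
    rw [YoungDiagram.mem_cells, mem_hook]; omega
  have hn2 : (l + 1, 0) ∉ (hook (a + 1) l).cells := by
    rw [YoungDiagram.mem_cells, mem_hook]; omega
  have hsub : ({(0, a + 1), (l + 1, 0)} : Finset (ℕ × ℕ)) ⊆ (hook (a + 1) (l + 1)).cells := by
    intro b hb
    rw [Finset.mem_insert, Finset.mem_singleton] at hb
    rcases hb with rfl | rfl <;> rw [YoungDiagram.mem_cells, mem_hook] <;> omega
  rw [numCells_succ, ← Finset.sum_subset hsub, Finset.sum_pair hne]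
  · congr 2
    · rw [insert_hook_arm, Finset.erase_insert hn1]
    · rw [insert_hook_leg, Finset.erase_insert hn2]
  · intro b hb hnb
    rw [Finset.mem_insert, Finset.mem_singleton, not_or] at hnb
    exact numCells_erase_hook hb (.inl hnb.1) (.inl hnb.2)

/-- The number of standard tableaux of a hook shape is a binomial coefficient. -/
theorem numCells_hook (a l : ℕ) :
    numCells (a + l + 1) (hook a l).cells * (a.factorial * l.factorial) = (a + l).factorial := by
  induction a generalizing l with
  | zero =>
    induction l with
    | zero => simp [numCells_hook_zero_zero]
    | succ l ih =>
      simp only [zero_add, Nat.factorial_zero, one_mul] at ih ⊢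
      rw [numCells_hook_zero_succ, Nat.factorial_succ, mul_left_comm, ih]
  | succ a iha =>
    induction l with
    | zero =>
      have ih := iha 0
      simp only [add_zero, Nat.factorial_zero, mul_one] at ih ⊢
      rw [numCells_hook_succ_zero, Nat.factorial_succ, mul_left_comm, ih]
    | succ l ihl =>
      have ih := iha (l + 1)
      rw [numCells_hook_succ_succ]
      rw [show a + (l + 1) = a + 1 + l by omega] at ih
      rw [show a + 1 + (l + 1) = a + 1 + l + 1 by omega, Nat.factorial_succ (a + 1 + l)]
      calc _ = (a + 1) * (numCells (a + 1 + l + 1) (hook a (l + 1)).cells *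
              (a.factorial * (l + 1).factorial)) +
            (l + 1) * (numCells (a + 1 + l + 1) (hook (a + 1) l).cells *
              ((a + 1).factorial * l.factorial)) := by
            rw [Nat.factorial_succ a, Nat.factorial_succ l]
            ring
        _ = _ := by
            rw [ih, ihl]
            ring

theorem SYT.pos_zero {k : ℕ} (T : SYT (k + 1)) : T.pos 0 = (0, 0) := by
  obtain ⟨i, hi⟩ : (0, 0) ∈ Set.range T.pos :=
    T.isLowerSet (a := T.pos 0) ⟨Nat.zero_le _, Nat.zero_le _⟩ ⟨0, rfl⟩
  have h : i ≤ 0 := T.le_of_pos_le (by rw [hi]; exact ⟨Nat.zero_le _, Nat.zero_le _⟩)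
  rw [← hi, Fin.le_zero_iff.1 h]

theorem prod_content_eq_zero {k : ℕ} {T : SYT (k + 1)} (h : (1, 1) ∈ T.shape) :
    ∏ a : Fin k, (T.content a.succ : ℂ) = 0 := by
  obtain ⟨i, hi⟩ := T.mem_shape.1 h
  have h0 : i ≠ 0 := by
    rintro rfl
    rw [T.pos_zero] at hi
    simp at hi
  obtain ⟨a, rfl⟩ := Fin.exists_succ_eq.2 h0
  refine Finset.prod_eq_zero (Finset.mem_univ a) ?_
  simp [SYT.content, hi]

theorem prod_content_hook {k a l : ℕ} {T : SYT (k + 1)} (h : T.shape = hook a l) :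
    ∏ i : Fin k, (T.content i.succ : ℂ) = (-1) ^ l * (a.factorial * l.factorial : ℕ) := by
  let g : ℕ × ℕ → ℂ := fun b => if b = (0, 0) then 1 else (b.2 : ℂ) - b.1
  have h1 : ∏ i : Fin (k + 1), g (T.pos i) = ∏ i : Fin k, (T.content i.succ : ℂ) := by
    rw [Fin.prod_univ_succ, T.pos_zero]
    simp only [g, if_true, one_mul]
    refine Finset.prod_congr rfl fun i _ => ?_
    rw [if_neg, SYT.content]
    · push_cast
      rfl
    · rw [← T.pos_zero]
      exact fun h => Fin.succ_ne_zero i (T.injective h)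
  have h2 : ∏ i : Fin (k + 1), g (T.pos i) = ∏ b ∈ T.shape.cells, g b := by
    rw [SYT.shape, Finset.prod_image fun x _ y _ h => T.injective h]
  rw [← h1, h2, h, prod_hook, Finset.prod_range_succ']
  have h3 : ∀ c ∈ Finset.range a, g (0, c + 1) = ((c + 1 : ℕ) : ℂ) := fun c _ => by simp [g]
  have h4 : ∀ r ∈ Finset.range l, g (r + 1, 0) = -1 * ((r + 1 : ℕ) : ℂ) := fun r _ => by
    simp [g]
  rw [Finset.prod_congr rfl h3, Finset.prod_congr rfl h4, Finset.prod_mul_distrib,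
    ← Nat.cast_prod, ← Nat.cast_prod, Finset.prod_range_add_one_eq_factorial,
    Finset.prod_range_add_one_eq_factorial]
  simp only [g, if_true, Finset.prod_const, Finset.card_range]
  push_cast
  ring

theorem exists_eq_hook {k : ℕ} {T : SYT (k + 1)} (h : (1, 1) ∉ T.shape) :
    ∃ a l, a + l = k ∧ T.shape = hook a l := by
  have h00 : (0, 0) ∈ T.shape := T.mem_shape.2 ⟨0, T.pos_zero⟩
  have hr := YoungDiagram.mem_iff_lt_rowLen.1 h00
  have hc := YoungDiagram.mem_iff_lt_colLen.1 h00
  have heq : T.shape = hook (T.shape.rowLen 0 - 1) (T.shape.colLen 0 - 1) := by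
    ext ⟨r, c⟩
    rw [YoungDiagram.mem_cells, YoungDiagram.mem_cells, mem_hook]
    have h1 : (0, c) ∈ T.shape ↔ c < T.shape.rowLen 0 := YoungDiagram.mem_iff_lt_rowLen
    have h2 : (r, 0) ∈ T.shape ↔ r < T.shape.colLen 0 := YoungDiagram.mem_iff_lt_colLen
    rcases Nat.eq_zero_or_pos r with rfl | hr0
    · rw [h1]
      omega
    rcases Nat.eq_zero_or_pos c with rfl | hc0
    · rw [h2]
      omega
    · refine iff_of_false (fun h3 => h (T.shape.isLowerSet ?_ h3)) (by omega)
      exact ⟨hr0, hc0⟩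
  refine ⟨_, _, ?_, heq⟩
  have h3 := T.card_cells_shape
  rw [heq, card_hook] at h3
  omega

theorem rowLen_eq {Y : YoungDiagram} {r x : ℕ} (h : ∀ c, (r, c) ∈ Y ↔ c < x) :
    Y.rowLen r = x := by
  simp only [YoungDiagram.mem_iff_lt_rowLen] at h
  have h1 := h x
  have h2 := h (Y.rowLen r)
  omega

theorem colLen_eq {Y : YoungDiagram} {c x : ℕ} (h : ∀ r, (r, c) ∈ Y ↔ r < x) :
    Y.colLen c = x := by
  simp only [YoungDiagram.mem_iff_lt_colLen] at h
  have h1 := h x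
  have h2 := h (Y.colLen c)
  omega

theorem rowLens_hook (a l : ℕ) :
    ((hook a l).rowLens : Multiset ℕ) = (a + 1) ::ₘ Multiset.replicate l 1 := by
  have h : (hook a l).rowLens = (a + 1) :: List.replicate l 1 := by
    rw [YoungDiagram.rowLens, colLen_eq (x := l + 1) (fun r => by rw [mem_hook]; omega),
      List.range_succ_eq_map, List.map_cons, List.map_map,
      rowLen_eq (x := a + 1) (fun c => by rw [mem_hook]; omega)]
    congr 1
    rw [List.eq_replicate_iff]
    refine ⟨by simp, fun x hx => ?_⟩
    obtain ⟨r, hr, rfl⟩ := List.mem_map.1 hx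
    rw [List.mem_range] at hr
    exact rowLen_eq fun c => by rw [mem_hook]; omega
  rw [h, ← Multiset.coe_replicate]
  rfl

/-- The row lengths of a hook to which the inner corner box has been added. -/
theorem rowLens_of_cells_eq_insert {Y : YoungDiagram} {a l : ℕ}
    (hY : Y.cells = insert (1, 1) (hook (a + 1) (l + 1)).cells) :
    (Y.rowLens : Multiset ℕ) = (a + 2) ::ₘ 2 ::ₘ Multiset.replicate l 1 := by
  have hmem : ∀ r c, (r, c) ∈ Y ↔ r = 1 ∧ c = 1 ∨ r = 0 ∧ c ≤ a + 1 ∨ c = 0 ∧ r ≤ l + 1 := by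
    intro r c
    rw [← YoungDiagram.mem_cells, hY, Finset.mem_insert, YoungDiagram.mem_cells, mem_hook,
      Prod.mk.injEq]
  have h : Y.rowLens = (a + 2) :: 2 :: List.replicate l 1 := by
    rw [YoungDiagram.rowLens, colLen_eq (x := l + 2) (fun r => by rw [hmem]; omega),
      List.range_succ_eq_map, List.map_cons, List.map_map, List.range_succ_eq_map, List.map_cons,
      List.map_map, rowLen_eq (x := a + 2) (fun c => by rw [hmem]; omega)]
    congr 1
    rw [Function.comp_apply, rowLen_eq (x := 2) (fun c => by rw [hmem]; omega)]
    congr 1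
    rw [List.eq_replicate_iff]
    refine ⟨by simp, fun x hx => ?_⟩
    obtain ⟨r, hr, rfl⟩ := List.mem_map.1 hx
    rw [List.mem_range] at hr
    exact rowLen_eq fun c => by rw [hmem]; omega
  rw [h, ← Multiset.coe_replicate]
  rfl

theorem eq_of_notMem_hook {a l : ℕ} {b : ℕ × ℕ} (hb : b ∉ hook a l)
    (hl : IsLowerSet ((insert b (hook a l).cells : Finset (ℕ × ℕ)) : Set (ℕ × ℕ))) :
    b = (0, a + 1) ∨ b = (l + 1, 0) ∨ b = (1, 1) ∧ 1 ≤ a ∧ 1 ≤ l := by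
  obtain ⟨r, c⟩ := b
  have key : ∀ r' c' : ℕ, r' ≤ r → c' ≤ c → (r' = r ∧ c' = c) ∨ (r', c') ∈ hook a l := by
    intro r' c' h1 h2
    have h3 : (r', c') ∈ ((insert (r, c) (hook a l).cells : Finset (ℕ × ℕ)) : Set (ℕ × ℕ)) :=
      hl (Prod.mk_le_mk.2 ⟨h1, h2⟩) (by simp)
    simpa only [Finset.coe_insert, Set.mem_insert_iff, Prod.mk.injEq, Finset.mem_coe,
      YoungDiagram.mem_cells] using h3
  simp only [mem_hook] at key hb
  simp only [Prod.mk.injEq]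
  have k1 := key 0 (a + 1)
  have k2 := key (l + 1) 0
  have k3 := key 1 1
  have k4 := key 0 1
  have k5 := key 1 0
  omega

/-! ### The evaluation -/

/-- The generalized character where deleting the marked box from `μ` leaves a hook. -/
theorem genChar_eq_of_hook {k a l : ℕ} (hal : a + l = k) {ν : (k + 2).Partition}
    (hν : ν.parts = {k + 1, 1}) {μ : (k + 2).Partition} {Y : YoungDiagram} {b : ℕ × ℕ}
    (hb : b ∉ hook a l) (hY : Y.cells = insert b (hook a l).cells)
    (hμ : (Y.rowLens : Multiset ℕ) = μ.parts) : genChar μ (b.2 + 1) ν 1 = (-1) ^ l := by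
  subst hal
  have h := factorial_mul_genChar hν μ (b.2 + 1)
  have hf : (Finset.univ.filter fun T : SYT (a + l + 2) => T.HasMarkedShape μ (b.2 + 1)) =
      Finset.univ.filter fun T : SYT (a + l + 2) =>
        T.star.shape.cells = (hook a l).cells ∧ T.pos (Fin.last (a + l + 1)) = b := by
    ext T
    simp only [Finset.mem_filter, Finset.mem_univ, true_and, hasMarkedShape_iff_star hb hY hμ T,
      YoungDiagram.ext_iff]
  rw [hf, Finset.sum_congr rfl fun T hT =>
      prod_content_hook (YoungDiagram.ext (Finset.mem_filter.1 hT).2.1),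
    Finset.sum_const, card_star_eq hb (by rw [← hY]; exact Y.isLowerSet), nsmul_eq_mul,
    mul_left_comm, ← Nat.cast_mul, numCells_hook, mul_comm] at h
  exact mul_right_cancel₀ (factorial_cast_ne_zero _) h

end NearCentral

theorem lemma2 (n : ℕ) (hn : 2 ≤ n) (ν : n.Partition) (hν : ν.parts = {n - 1, 1})
    (μ : n.Partition) (j : ℕ) (hj : j ∈ μ.parts) :
    (∃ a, NearCentral.IsExpansion (NearCentral.bigGamma μ j) a) ∧
    (∀ k, NearCentral.IsNearHookTwo μ j k → NearCentral.genChar μ j ν 1 = (-1) ^ k) ∧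
    (∀ k, NearCentral.IsHookArm μ j k → NearCentral.genChar μ j ν 1 = (-1) ^ k) ∧
    (∀ k, NearCentral.IsHookLeg μ j k → NearCentral.genChar μ j ν 1 = (-1) ^ (k - 1)) ∧
    ((¬ ∃ k, NearCentral.IsNearHookTwo μ j k ∨ NearCentral.IsHookArm μ j k ∨
        NearCentral.IsHookLeg μ j k) → NearCentral.genChar μ j ν 1 = 0) := by
  open NearCentral in
  obtain ⟨m, rfl⟩ : ∃ m, n = m + 2 := ⟨n - 2, by omega⟩
  refine ⟨exists_isExpansion fun y => bigGamma_commute (n := m + 1) μ j y, ?_, ?_, ?_, ?_⟩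
  · rintro k ⟨h1, h2, h3, rfl⟩
    obtain ⟨l, rfl⟩ : ∃ l, k = l + 1 := ⟨k - 1, by omega⟩
    obtain ⟨a, rfl⟩ : ∃ a, m = a + 1 + (l + 1) := ⟨m - l - 2, by omega⟩
    have hb : ((1, 1) : ℕ × ℕ) ∉ hook (a + 1) (l + 1) := by rw [mem_hook]; omega
    have hlow : IsLowerSet
        ((insert (1, 1) (hook (a + 1) (l + 1)).cells : Finset (ℕ × ℕ)) : Set (ℕ × ℕ)) := by
      rintro ⟨r, c⟩ ⟨r', c'⟩ hle h
      rw [Prod.mk_le_mk] at hle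
      simp only [Finset.coe_insert, Set.mem_insert_iff, Prod.mk.injEq, Finset.mem_coe,
        YoungDiagram.mem_cells, mem_hook] at h ⊢
      omega
    refine genChar_eq_of_hook (b := (1, 1)) rfl hν hb (Y := ⟨_, hlow⟩) rfl ?_
    rw [rowLens_of_cells_eq_insert rfl, h3]
    congr 1
    omega
  · rintro k ⟨h1, h2, rfl⟩
    obtain ⟨a, rfl⟩ : ∃ a, m = a + k := ⟨m - k, by omega⟩
    have hb : ((0, a + 1) : ℕ × ℕ) ∉ hook a k := by rw [mem_hook]; omega
    have h := genChar_eq_of_hook (b := (0, a + 1)) rfl hν hb (insert_hook_arm a k) (μ := μ) (by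
      rw [rowLens_hook, h2]
      congr 1
      omega)
    rwa [show a + k + 2 - k = a + 1 + 1 by omega]
  · rintro k ⟨h1, h2, h3, rfl⟩
    obtain ⟨l, rfl⟩ : ∃ l, k = l + 1 := ⟨k - 1, by omega⟩
    obtain ⟨a, rfl⟩ : ∃ a, m = a + l := ⟨m - l, by omega⟩
    have hb : ((l + 1, 0) : ℕ × ℕ) ∉ hook a l := by rw [mem_hook]; omega
    refine genChar_eq_of_hook (b := (l + 1, 0)) rfl hν hb (insert_hook_leg a l) ?_
    rw [rowLens_hook, h3]
    congr 1
    omega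
  · intro hno
    have h := factorial_mul_genChar hν μ j
    rw [Finset.sum_eq_zero] at h
    · exact (mul_eq_zero.1 h).resolve_left (factorial_cast_ne_zero m)
    intro T hT
    refine prod_content_eq_zero ?_
    by_contra h11
    -- The tableau arises from a hook by adding a box, which leaves only the exceptional cases.
    obtain ⟨a, l, rfl, hhook⟩ := exists_eq_hook h11
    obtain ⟨hμ, -, rfl⟩ := hasMarkedShape_iff.1 (Finset.mem_filter.1 hT).2
    have hcells := T.cells_shape_star
    have hnot := T.last_notMem_star
    have hlow : IsLowerSet (T.shape.cells : Set (ℕ × ℕ)) := T.shape.isLowerSet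
    rw [SYT.HasShape] at hμ
    rw [hhook] at hcells hnot
    rw [hcells] at hlow
    rcases eq_of_notMem_hook hnot hlow with hb | hb | ⟨hb, ha, hl⟩
    · rw [hb] at hcells hno
      rw [← insert_hook_arm] at hcells
      rw [YoungDiagram.ext hcells, rowLens_hook] at hμ
      refine hno ⟨l, .inr (.inl ⟨by omega, ?_, by simp only; omega⟩)⟩
      rw [← hμ]
      congr 1
      omega
    · rw [hb] at hcells hno
      rw [← insert_hook_leg] at hcells
      rw [YoungDiagram.ext hcells, rowLens_hook] at hμ
      refine hno ⟨l + 1, .inr (.inr ⟨by omega, by omega, ?_, rfl⟩)⟩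
      rw [← hμ]
      congr 1
      omega
    · obtain ⟨a, rfl⟩ : ∃ a', a = a' + 1 := ⟨a - 1, by omega⟩
      obtain ⟨l, rfl⟩ : ∃ l', l = l' + 1 := ⟨l - 1, by omega⟩
      rw [hb] at hcells hno
      rw [rowLens_of_cells_eq_insert hcells] at hμ
      refine hno ⟨l + 1, .inl ⟨by omega, by omega, ?_, rfl⟩⟩
      rw [← hμ]
      congr 1
      omega

end
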